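/- Let $p\ge 0$ and let $\Sigma$ be a non-empty smooth (Hausdorff) manifold with $\dim\Sigma\ge p+2$. Consider gauge fields $A^\alpha$ on $\Sigma$: scalar fields $X=(X^1,\dots,X^n)\colon\Sigma\to U$ with values in an open set $U\subseteq\mathbb R^n$ (degree $|i|=0$), and finitely many differential forms $A^a$ of degrees $1\le|a|\le p$. Let the field strengths be given by the general ansatz $$F^\alpha=dA^\alpha+t^\alpha_\beta(X)\,A^\beta+\tfrac12C^\alpha_{\beta\gamma}(X)\,A^\beta\wedge A^\gamma+\tfrac16H^\alpha_{\beta\gamma\delta}(X)\,A^\beta\wedge A^\gamma\wedge A^\delta+\dots,$$ where the lower indices run over the gauge fields of positive degree, the coefficients are arbitrary smooth functions on $U$, and only terms of form degree $|\alpha|+1$ occur. On the graded manifold with coordinates $q^\alpha$ of degree $|\alpha|$ ($q^i=x^i\in U$ for the scalars), i.e. on the graded commutative algebra $C^\infty(U)\otimes\mathbb R[q^a:|a|\text{ even}]\otimes\Lambda\langle q^a:|a|\text{ odd}\rangle$, consider the degree $1$ vector field $$Q=\Bigl(t^\alpha_\beta(x)\,q^\beta+\tfrac12C^\alpha_{\beta\gamma}(x)\,q^\beta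 q^\gamma+\tfrac16H^\alpha_{\beta\gamma\delta}(x)\,q^\beta q^\gamma q^\delta+\dots\Bigr)\frac{\partial}{\partial q^\alpha}.$$ Then the generalized Bianchi identities hold if and only if $Q^2=0$. This is true for each of the following three formulations of the generalized Bianchi identities (which are therefore equivalent): 1. $d\mathcal I\subset\mathcal I$, where $\mathcal I$ is the ideal generated by the $F^\alpha$ in the algebra, generated by the $A^\alpha$ and $dA^\alpha$ and with smooth dependence on the $X^i$, of form-valued functionals of the gauge fields on $\Sigma$; 2. $d\mathcal I\subset\mathcal I$, where $\mathcal I$ is the ideal generated by the $F^\alpha$ in the differential graded commutative algebra freely generated by abstract elements $A^\alpha$ and $dA^\alpha$, with smooth dependence on the degree $0$ elements $X^i\in U$; 3. $dF^\alpha|_{F^\beta=0}\equiv0$: for all gauge fields on $\Sigma$ and every point $\sigma\in\Sigma$ such that $F^\beta(\sigma)=0$ for all $\beta$, one has $(dF^\alpha)(\sigma)=0$ for all $\alpha$. -/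

import Mathlib

open scoped TensorProduct Manifold ContDiff
open TopologicalSpace

noncomputable section

namespace HigherGauge

/-- The coordinate space `ℝⁿ`. -/
abbrev Euc (n : ℕ) : Type := EuclideanSpace ℝ (Fin n)

section SmoothFunctions

variable {n : ℕ}

/-- The smooth functions on an open set `U ⊆ ℝⁿ`, as a subalgebra of all functions on `U`. -/
def smoothSubalgebra (U : Opens (Euc n)) : Subalgebra ℝ (U → ℝ) where
  carrier := {f | ∃ g : Euc n → ℝ, ContDiffOn ℝ ∞ g U ∧ ∀ x : U, f x = g x}
  mul_mem' := by
    rintro f₁ f₂ ⟨g₁, h₁, e₁⟩ ⟨g₂, h₂, e₂⟩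
    exact ⟨fun x => g₁ x * g₂ x, h₁.mul h₂, fun x => by simp [e₁ x, e₂ x]⟩
  add_mem' := by
    rintro f₁ f₂ ⟨g₁, h₁, e₁⟩ ⟨g₂, h₂, e₂⟩
    exact ⟨fun x => g₁ x + g₂ x, h₁.add h₂, fun x => by simp [e₁ x, e₂ x]⟩
  algebraMap_mem' := fun r => ⟨fun _ => r, contDiffOn_const, fun _ => rfl⟩

/-- The algebra `C^∞(U)` for an open set `U ⊆ ℝⁿ`. -/
def SmoothFun (U : Opens (Euc n)) : Type := smoothSubalgebra U

instance (U : Opens (Euc n)) : CommRing (SmoothFun U) :=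
  inferInstanceAs (CommRing (smoothSubalgebra U))

instance (U : Opens (Euc n)) : Algebra ℝ (SmoothFun U) :=
  inferInstanceAs (Algebra ℝ (smoothSubalgebra U))

/-- Extension by zero of a function on `U`; it only serves to differentiate at points of `U`. -/
def extendZero {U : Opens (Euc n)} (f : U → ℝ) : Euc n → ℝ :=
  Function.extend Subtype.val f 0

theorem extendZero_apply {U : Opens (Euc n)} (f : U → ℝ) (x : U) :
    extendZero f (x : Euc n) = f x :=
  Subtype.val_injective.extend_apply f 0 x

theorem extendZero_apply_of_notMem {U : Opens (Euc n)} (f : U → ℝ) {y : Euc n} (hy : y ∉ U) :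
    extendZero f y = 0 :=
  Function.extend_apply' _ _ _ fun ⟨a, ha⟩ => hy (ha ▸ a.2)

theorem extendZero_add {U : Opens (Euc n)} (f g : U → ℝ) :
    extendZero (f + g) = extendZero f + extendZero g := by
  funext y
  by_cases hy : y ∈ U
  · exact (extendZero_apply (f + g) ⟨y, hy⟩).trans
      (congrArg₂ (· + ·) (extendZero_apply f ⟨y, hy⟩) (extendZero_apply g ⟨y, hy⟩)).symm
  · simp [extendZero_apply_of_notMem _ hy]

theorem extendZero_smul {U : Opens (Euc n)} (r : ℝ) (f : U → ℝ) :
    extendZero (r • f) = r • extendZero f := by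
  funext y
  by_cases hy : y ∈ U
  · exact (extendZero_apply (r • f) ⟨y, hy⟩).trans
      (congrArg (r • ·) (extendZero_apply f ⟨y, hy⟩)).symm
  · simp [extendZero_apply_of_notMem _ hy]

theorem extendZero_contDiffOn {U : Opens (Euc n)} (f : SmoothFun U) :
    ContDiffOn ℝ ∞ (extendZero f.1) U := by
  obtain ⟨g, hg, e⟩ := f.2
  exact hg.congr fun x hx => by rw [extendZero_apply f.1 ⟨x, hx⟩, e ⟨x, hx⟩]

theorem extendZero_differentiableAt {U : Opens (Euc n)} (f : SmoothFun U) (x : U) :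
    DifferentiableAt ℝ (extendZero f.1) (x : Euc n) :=
  ((extendZero_contDiffOn f).differentiableOn (by simp)).differentiableAt
    (U.isOpen.mem_nhds x.2)

/-- The partial derivative `∂/∂xⁱ : C^∞(U) → C^∞(U)`. -/
def pd (U : Opens (Euc n)) (i : Fin n) : SmoothFun U →ₗ[ℝ] SmoothFun U where
  toFun f :=
    ⟨fun x => fderiv ℝ (extendZero f.1) (x : Euc n) (EuclideanSpace.single i 1),
      fun x => fderiv ℝ (extendZero f.1) x (EuclideanSpace.single i 1),
      ((extendZero_contDiffOn f).fderiv_of_isOpen U.isOpen (by simp)).clm_apply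
        contDiffOn_const,
      fun _ => rfl⟩
  map_add' f g := by
    refine Subtype.ext (funext fun x => ?_)
    change fderiv ℝ (extendZero (f.1 + g.1)) (x : Euc n) _ = _
    rw [extendZero_add,
      fderiv_add (extendZero_differentiableAt f x) (extendZero_differentiableAt g x)]
    rfl
  map_smul' r f := by
    refine Subtype.ext (funext fun x => ?_)
    change fderiv ℝ (extendZero (r • f.1)) (x : Euc n) _ = _
    rw [extendZero_smul, fderiv_const_smul (extendZero_differentiableAt f x)]
    rfl

/-- The coordinate function `xⁱ ∈ C^∞(U)`. -/
def xcoord (U : Opens (Euc n)) (i : Fin n) : SmoothFun U :=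
  ⟨fun x => (x : Euc n) i, fun x => x i, by fun_prop, fun _ => rfl⟩

/-- Evaluation of smooth functions at a point of `U`. -/
def evalAt {U : Opens (Euc n)} (x : U) : SmoothFun U →ₐ[ℝ] ℝ :=
  (Pi.evalAlgHom ℝ (fun _ : U => ℝ) x).comp (smoothSubalgebra U).val

end SmoothFunctions

section GradedManifold

variable {n : ℕ} {κ : Type*}

/-- Polynomials in commuting variables `q^a`, `a : κ`, with real coefficients. -/
def EvenPoly (κ : Type*) : Type _ := MvPolynomial κ ℝ

instance (κ : Type*) : CommRing (EvenPoly κ) := inferInstanceAs (CommRing (MvPolynomial κ ℝ))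

instance (κ : Type*) : Algebra ℝ (EvenPoly κ) := inferInstanceAs (Algebra ℝ (MvPolynomial κ ℝ))

/-- The variable `q^a`. -/
def EvenPoly.X {κ : Type*} (a : κ) : EvenPoly κ := (MvPolynomial.X a : MvPolynomial κ ℝ)

/-- The partial derivative `∂/∂q^a` of polynomials. -/
def EvenPoly.pderiv {κ : Type*} (a : κ) : EvenPoly κ →ₗ[ℝ] EvenPoly κ :=
  (MvPolynomial.pderiv a : Derivation ℝ (MvPolynomial κ ℝ) (MvPolynomial κ ℝ)).toLinearMap

/-- Functions on the graded manifold with body `U ⊆ ℝⁿ` and further global coordinates `q^a`,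
`a : κ`, of degree `deg a`: the graded commutative algebra
`C^∞(U) ⊗ ℝ[q^a : deg a even] ⊗ Λ⟨q^a : deg a odd⟩`. -/
abbrev GradedFun (U : Opens (Euc n)) (deg : κ → ℕ) : Type _ :=
  SmoothFun U ⊗[ℝ] (EvenPoly {a : κ // Even (deg a)} ⊗[ℝ]
    ExteriorAlgebra ℝ ({a : κ // ¬ Even (deg a)} →₀ ℝ))

/-- A smooth function of the degree 0 coordinates as a function on the graded manifold. -/
def baseFun (U : Opens (Euc n)) (deg : κ → ℕ) (f : SmoothFun U) : GradedFun U deg :=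
  f ⊗ₜ 1

/-- The coordinate function `q^a`. -/
def coord (U : Opens (Euc n)) (deg : κ → ℕ) (a : κ) : GradedFun U deg :=
  if h : Even (deg a) then 1 ⊗ₜ (EvenPoly.X ⟨a, h⟩ ⊗ₜ 1)
  else 1 ⊗ₜ (1 ⊗ₜ ExteriorAlgebra.ι ℝ (Finsupp.single ⟨a, h⟩ 1))

/-- The left partial derivatives `∂/∂xⁱ` and `∂/∂q^a` on functions on the graded manifold. -/
def partialD (U : Opens (Euc n)) (deg : κ → ℕ) :
    Fin n ⊕ κ → (GradedFun U deg →ₗ[ℝ] GradedFun U deg)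
  | .inl i => TensorProduct.map (pd U i) LinearMap.id
  | .inr a =>
    if h : Even (deg a) then
      TensorProduct.map LinearMap.id
        (TensorProduct.map (EvenPoly.pderiv ⟨a, h⟩) LinearMap.id)
    else
      TensorProduct.map LinearMap.id
        (TensorProduct.map LinearMap.id
          (CliffordAlgebra.contractLeft (Q := 0) (Finsupp.lapply ⟨a, h⟩)))

/-- The vector field `∑ V^α ∂/∂q^α` with components `V^α`, where `q^α` runs through all
coordinates `xⁱ`, `q^a`. -/
def vectorField [Fintype κ] (U : Opens (Euc n)) (deg : κ → ℕ)
    (V : Fin n ⊕ κ → GradedFun U deg) : GradedFun U deg →ₗ[ℝ] GradedFun U deg :=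
  ∑ α, LinearMap.mulLeft ℝ (V α) ∘ₗ partialD U deg α

end GradedManifold

section FieldStrengths

variable {n : ℕ} {ι : Type*}

/-- Form degree of the gauge field `A^α`: the scalar fields `Xⁱ` have degree 0, the remaining
gauge fields `A^a` have degree `deg a`. -/
def fieldDeg (n : ℕ) (deg : ι → ℕ) : Fin n ⊕ ι → ℕ :=
  Sum.elim (fun _ => 0) deg

/-- The coefficients of the general ansatz
`F^α = dA^α + ∑_{k ≥ 1} (1/k!) c^α_{β₁ … β_k}(X) A^{β₁} ∧ … ∧ A^{β_k}`, where the `A^β` have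
positive degree: arbitrary smooth functions of the scalar fields, subject only to the
compatibility with the form degrees. -/
structure Ansatz (U : Opens (Euc n)) (deg : ι → ℕ) where
  coeff : Fin n ⊕ ι → (k : ℕ) → (Fin k → ι) → SmoothFun U
  homogeneous : ∀ α k β, ∑ j, deg (β j) ≠ fieldDeg n deg α + 1 → coeff α k β = 0

/-- The polynomial part `t^α_β A^β + ½ C^α_{βγ} A^β A^γ + ⅙ H^α_{βγδ} A^β A^γ A^δ + …` of the
ansatz, evaluated in an algebra `B`: `φ` inserts the scalars into the coefficient functions,
and `A` gives the elements of positive degree. As these have degree at least 1, only terms with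
at most `deg α + 1` factors have the correct degree. -/
def Ansatz.poly [Fintype ι] {U : Opens (Euc n)} {deg : ι → ℕ} (c : Ansatz U deg)
    {B : Type*} [Ring B] [Algebra ℝ B] (φ : SmoothFun U → B) (A : ι → B) (α : Fin n ⊕ ι) : B :=
  ∑ k ∈ Finset.Icc 1 (fieldDeg n deg α + 1),
    ((k.factorial : ℝ)⁻¹) •
      ∑ β : Fin k → ι, φ (c.coeff α k β) * (List.ofFn fun j => A (β j)).prod

/-- The degree 1 vector field
`Q = (t^α_β(x) q^β + ½ C^α_{βγ}(x) q^β q^γ + …) ∂/∂q^α` on the target graded manifold. -/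
def Ansatz.Q [Fintype ι] {U : Opens (Euc n)} {deg : ι → ℕ} (c : Ansatz U deg) :
    GradedFun U deg →ₗ[ℝ] GradedFun U deg :=
  vectorField U deg fun α => c.poly (baseFun U deg) (coord U deg) α

end FieldStrengths

section AbstractIdeal

variable {n : ℕ} {ι : Type*}

/-- Generators of the algebra of abstract gauge fields other than the `Xⁱ`:
the `A^a`, the `dXⁱ` and the `dA^a`. -/
abbrev JetIndex (n : ℕ) (ι : Type*) : Type _ := ι ⊕ (Fin n ⊕ ι)

/-- Degrees of these generators. -/
def jetDeg (n : ℕ) (deg : ι → ℕ) : JetIndex n ι → ℕ :=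
  Sum.elim deg fun α => fieldDeg n deg α + 1

/-- The graded commutative algebra generated by abstract elements `A^α` and `dA^α`, with smooth
dependence on the elements `Xⁱ` of degree 0. -/
abbrev FieldAlg (U : Opens (Euc n)) (deg : ι → ℕ) : Type _ :=
  GradedFun U (jetDeg n deg)

/-- The differential of this algebra: `d(A^α) = dA^α`, `d(dA^α) = 0`. -/
def fieldD [Fintype ι] (U : Opens (Euc n)) (deg : ι → ℕ) :
    FieldAlg U deg →ₗ[ℝ] FieldAlg U deg :=
  vectorField U (jetDeg n deg) fun
    | .inl i => coord U (jetDeg n deg) (.inr (.inl i))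
    | .inr (.inl a) => coord U (jetDeg n deg) (.inr (.inr a))
    | .inr (.inr _) => 0

/-- The field strengths `F^α` as elements of the algebra of abstract gauge fields. -/
def Ansatz.fieldStrength [Fintype ι] {U : Opens (Euc n)} {deg : ι → ℕ} (c : Ansatz U deg)
    (α : Fin n ⊕ ι) : FieldAlg U deg :=
  coord U (jetDeg n deg) (.inr α) +
    c.poly (baseFun U (jetDeg n deg)) (fun a => coord U (jetDeg n deg) (.inl a)) α

/-- Generalized Bianchi identities `d𝓘 ⊆ 𝓘`, where `𝓘` is the ideal generated by the `F^α` in the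
algebra generated by abstract elements `A^α` and `dA^α`. -/
def Ansatz.AbstractBianchi [Fintype ι] {U : Opens (Euc n)} {deg : ι → ℕ}
    (c : Ansatz U deg) : Prop :=
  ∀ x ∈ TwoSidedIdeal.span (Set.range c.fieldStrength),
    fieldD U deg x ∈ TwoSidedIdeal.span (Set.range c.fieldStrength)

end AbstractIdeal

section Spacetime

variable {m : ℕ}

/-- The exterior algebra of the cotangent space of `ℝᵐ`. -/
abbrev ExtCov (m : ℕ) : Type := ExteriorAlgebra ℝ (Module.Dual ℝ (Euc m))

/-- Differential forms on an open set `V ⊆ ℝᵐ`, i.e. functions on `T[1]V`. -/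
abbrev LocalForm (V : Opens (Euc m)) : Type := SmoothFun V ⊗[ℝ] ExtCov m

/-- The coordinate differential `dσ^μ`. -/
def dσ (μ : Fin m) : Module.Dual ℝ (Euc m) := (EuclideanSpace.proj (𝕜 := ℝ) μ).toLinearMap

/-- The exterior derivative `d = ∑ dσ^μ ∧ ∂/∂σ^μ` on an open set `V ⊆ ℝᵐ`. -/
def localD (V : Opens (Euc m)) : LocalForm V →ₗ[ℝ] LocalForm V :=
  ∑ μ, LinearMap.mulLeft ℝ ((1 : SmoothFun V) ⊗ₜ[ℝ] ExteriorAlgebra.ι ℝ (dσ μ)) ∘ₗ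
    TensorProduct.map (pd V μ) LinearMap.id

/-- The value of a form at a point of `V`. -/
def formAt {V : Opens (Euc m)} (y : V) : LocalForm V →ₐ[ℝ] ExtCov m :=
  (Algebra.TensorProduct.lid ℝ (ExtCov m)).toAlgHom.comp
    (Algebra.TensorProduct.map (evalAt y) (AlgHom.id ℝ (ExtCov m)))

variable (m) (S : Type*) [TopologicalSpace S] [ChartedSpace (Euc m) S]

/-- The open subset of `ℝᵐ` onto which a chart of the manifold `S` maps. -/
def chartTarget {m : ℕ} {S : Type*} [TopologicalSpace S] [ChartedSpace (Euc m) S]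
    (e : atlas (Euc m) S) : Opens (Euc m) :=
  ⟨e.1.target, e.1.open_target⟩

/-- A smooth differential form of degree `k` on the manifold `S`, given by its expressions in the
charts of the atlas, which are related by pullback along the changes of coordinates. -/
structure DiffForm (k : ℕ) where
  inChart : (e : atlas (Euc m) S) → LocalForm (chartTarget e)
  degree : ∀ e (y : chartTarget e),
    formAt y (inChart e) ∈ ⋀[ℝ]^k (Module.Dual ℝ (Euc m))
  compat : ∀ (e e' : atlas (Euc m) S) (y : chartTarget e) (y' : chartTarget e'),
    e.1.symm y = e'.1.symm y' →
      formAt y (inChart e) =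
        ExteriorAlgebra.map
          (fderiv ℝ (fun z => e'.1 (e.1.symm z)) (y : Euc m)).toLinearMap.dualMap
          (formAt y' (inChart e'))

variable {n : ℕ} {ι : Type*}

/-- A configuration of gauge fields on `S`: scalar fields `X : S → U ⊆ ℝⁿ` and differential forms
`A^a` of degree `deg a`. -/
structure GaugeField (U : Opens (Euc n)) (deg : ι → ℕ) where
  X : S → Euc n
  smooth : ContMDiff (𝓡 m) (𝓡 n) ∞ X
  mem : ∀ s, X s ∈ U
  A : (a : ι) → DiffForm m S (deg a)

variable {m S}

/-- The function `f(X)` in a chart, for a smooth function `f` on the target `U`. -/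
def GaugeField.funOfX [IsManifold (𝓡 m) ∞ S] {U : Opens (Euc n)} {deg : ι → ℕ}
    (Φ : GaugeField m S U deg) (e : atlas (Euc m) S) (f : SmoothFun U) :
    SmoothFun (chartTarget e) :=
  ⟨fun y => f.1 ⟨Φ.X (e.1.symm y), Φ.mem _⟩,
    fun y => extendZero f.1 (Φ.X (e.1.symm y)), by
      have he : e.1 ∈ IsManifold.maximalAtlas (𝓡 m) ∞ S :=
        IsManifold.subset_maximalAtlas e.2
      have h : ContDiffOn ℝ ∞ (fun y => Φ.X (e.1.symm y)) e.1.target :=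
        contMDiffOn_iff_contDiffOn.1
          (Φ.smooth.comp_contMDiffOn (contMDiffOn_symm_of_mem_maximalAtlas he))
      exact (extendZero_contDiffOn f).comp h fun y _ => Φ.mem _,
    fun y => (extendZero_apply f.1 ⟨Φ.X (e.1.symm y), Φ.mem _⟩).symm⟩

variable (m S)

/-- Functionals of the gauge fields with values in (chart expressions of) forms on `S`. -/
abbrev Functional (U : Opens (Euc n)) (deg : ι → ℕ) : Type _ :=
  GaugeField m S U deg → (e : atlas (Euc m) S) → LocalForm (chartTarget e)

/-- The exterior derivative of a form-valued functional. -/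
def functionalD (U : Opens (Euc n)) (deg : ι → ℕ) (G : Functional m S U deg) :
    Functional m S U deg :=
  fun Φ e => localD (chartTarget e) (G Φ e)

variable [IsManifold (𝓡 m) ∞ S]

/-- The functional `f(X)` for `f ∈ C^∞(U)`. -/
def scalarFunctional (U : Opens (Euc n)) (deg : ι → ℕ) (f : SmoothFun U) :
    Functional m S U deg :=
  fun Φ e => Φ.funOfX e f ⊗ₜ 1

/-- The functional `A^α`, where `A^i = X^i` for the scalar fields. -/
def gaugeFunctional (U : Opens (Euc n)) (deg : ι → ℕ) : Fin n ⊕ ι → Functional m S U deg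
  | .inl i => scalarFunctional m S U deg (xcoord U i)
  | .inr a => fun Φ e => (Φ.A a).inChart e

/-- The algebra of form-valued functionals generated by the `A^α` and `dA^α`, with smooth
dependence on the scalar fields. -/
def functionalAlg (U : Opens (Euc n)) (deg : ι → ℕ) : Subalgebra ℝ (Functional m S U deg) :=
  Algebra.adjoin ℝ
    (Set.range (scalarFunctional m S U deg) ∪ Set.range (gaugeFunctional m S U deg) ∪
      Set.range fun α => functionalD m S U deg (gaugeFunctional m S U deg α))

/-- The field strengths `F^α` on the manifold `S`, as functionals of the gauge fields. -/
def Ansatz.fieldStrengthOn [Fintype ι] {U : Opens (Euc n)} {deg : ι → ℕ} (c : Ansatz U deg)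
    (α : Fin n ⊕ ι) : Functional m S U deg :=
  functionalD m S U deg (gaugeFunctional m S U deg α) +
    c.poly (scalarFunctional m S U deg) (fun a => gaugeFunctional m S U deg (.inr a)) α

/-- The ideal generated by the `F^α` in the algebra of functionals generated by the `A^α` and
`dA^α`. -/
def Ansatz.idealOn [Fintype ι] {U : Opens (Euc n)} {deg : ι → ℕ} (c : Ansatz U deg) :
    TwoSidedIdeal (functionalAlg m S U deg) :=
  TwoSidedIdeal.span
    {G | ∃ α, (G : Functional m S U deg) = c.fieldStrengthOn m S α}

/-- Generalized Bianchi identities `d𝓘 ⊆ 𝓘` for the gauge fields on the manifold `S`. -/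
def Ansatz.BianchiOn [Fintype ι] {U : Opens (Euc n)} {deg : ι → ℕ} (c : Ansatz U deg) : Prop :=
  ∀ G ∈ c.idealOn m S, ∃ G' ∈ c.idealOn m S,
    (G' : Functional m S U deg) = functionalD m S U deg G

/-- The pointwise form `dF^α |_{F = 0} = 0` of the generalized Bianchi identities: whenever all
field strengths of some gauge fields vanish at a point of `S`, so do their differentials. -/
def Ansatz.PointwiseBianchiOn [Fintype ι] {U : Opens (Euc n)} {deg : ι → ℕ}
    (c : Ansatz U deg) : Prop :=
  ∀ (Φ : GaugeField m S U deg) (e : atlas (Euc m) S) (y : chartTarget e),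
    (∀ β, formAt y (c.fieldStrengthOn m S β Φ e) = 0) →
      ∀ α, formAt y (functionalD m S U deg (c.fieldStrengthOn m S α) Φ e) = 0

end Spacetime

end HigherGauge

end

/-! Setting every $F^\alpha$ to zero means replacing $dA^\alpha$ by $-Q^\alpha$, where $Q^\alpha$
(`Ansatz.component`) is the polynomial part of the ansatz. This substitution is a retraction
`Ansatz.reduce` of the free algebra in $A^\alpha, dA^\alpha$ onto functions on the target, and its
kernel is exactly the ideal $\mathcal I$ (`Ansatz.mem_span_fieldStrength`). On functions of the
$A^\alpha$ alone, $d$ followed by the retraction is $-Q$: both are odd derivations, so it is enough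
to compare generators. As $d(dA^\alpha)=0$, the image of $dF^\alpha$ is $-Q(Q^\alpha)$. Hence
$d\mathcal I\subset\mathcal I$ gives $Q^2=0$ on coordinates and then everywhere. For base functions
this uses that the odd $Q^i$ anticommute while second partial derivatives commute. Conversely,
$Q^2=0$ makes the retraction intertwine $d$ with $-Q$, so its kernel is preserved by $d$.

On $\Sigma$, inserting actual gauge fields is a homomorphism compatible with $d$. It maps the
abstract algebra onto the algebra of functionals and $\mathcal I$ onto the concrete ideal
(`Ansatz.mem_idealOn`), so the abstract identities imply the concrete ones. Evaluation at a point
where all $F^\beta$ vanish kills the concrete ideal, which gives the pointwise identities.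

The remaining implication, from the pointwise identities to $Q^2=0$, needs the dimension. Values of
$X$, $A^a$ and all $dA^\alpha$ at a point can be prescribed independently
(`exists_gaugeField_with_jet`), so one can make $F$ vanish there while the values of $A$ stay
arbitrary. Then $dF^\alpha$ at the point is $-Q(Q^\alpha)$ evaluated on these values. This function
has degree $|\alpha|+2\le p+2\le\dim\Sigma$. A nonzero function of degree at most $m$ on the graded
manifold takes a nonzero value on suitable exterior forms in $m$ variables
(`exists_evalForms_ne_zero`): by induction, some $\partial/\partial q^a$ of it is detected, and
shifting $A^a$ by a product of fresh covectors turns this derivative into a nonzero contribution to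
the value. -/

noncomputable section

namespace HigherGauge

/-! ### Supercommutative algebras and skew derivations -/

section Parity

variable {B : Type*} [Ring B] [Algebra ℝ B]

/-- `σ` is the grading automorphism of a supercommutative algebra: `x + σ x` and `x - σ x` are
twice the even and the odd part of `x`. -/
structure IsParity (σ : B →ₐ[ℝ] B) : Prop where
  invol : ∀ x, σ (σ x) = x
  even_comm : ∀ x y, (x + σ x) * y = y * (x + σ x)
  odd_comm : ∀ x y, (x - σ x) * y = σ y * (x - σ x)

/-- `x` has parity `k` with respect to the grading automorphism `σ`. -/
def HasParity (σ : B →ₐ[ℝ] B) (k : ℕ) (x : B) : Prop := σ x = (-1 : ℝ) ^ k • x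

variable {σ : B →ₐ[ℝ] B}

theorem HasParity.even {k : ℕ} {x : B} (h : HasParity σ k x) (hk : Even k) : σ x = x := by
  rw [h, hk.neg_one_pow, one_smul]

theorem HasParity.odd {k : ℕ} {x : B} (h : HasParity σ k x) (hk : ¬ Even k) : σ x = -x := by
  rw [h, (Nat.not_even_iff_odd.1 hk).neg_one_pow, neg_one_smul]

theorem HasParity.of_even {k : ℕ} {x : B} (hk : Even k) (h : σ x = x) : HasParity σ k x := by
  rw [HasParity, h, hk.neg_one_pow, one_smul]

theorem HasParity.of_odd {k : ℕ} {x : B} (hk : ¬ Even k) (h : σ x = -x) : HasParity σ k x := by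
  rw [HasParity, h, (Nat.not_even_iff_odd.1 hk).neg_one_pow, neg_one_smul]

theorem HasParity.zero (k : ℕ) : HasParity σ k 0 := by simp [HasParity]

theorem HasParity.one : HasParity σ 0 1 := by simp [HasParity]

theorem HasParity.add {k : ℕ} {x y : B} (hx : HasParity σ k x) (hy : HasParity σ k y) :
    HasParity σ k (x + y) := by
  rw [HasParity, map_add, hx, hy, smul_add]

theorem HasParity.neg {k : ℕ} {x : B} (hx : HasParity σ k x) : HasParity σ k (-x) := by
  rw [HasParity, map_neg, hx, smul_neg]

theorem HasParity.smul {k : ℕ} {x : B} (r : ℝ) (hx : HasParity σ k x) :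
    HasParity σ k (r • x) := by
  rw [HasParity, map_smul, hx, smul_comm]

theorem HasParity.mul {k l : ℕ} {x y : B} (hx : HasParity σ k x) (hy : HasParity σ l y) :
    HasParity σ (k + l) (x * y) := by
  rw [HasParity, map_mul, hx, hy, smul_mul_smul_comm, pow_add]

theorem HasParity.list_prod {J : Type*} {A : J → B} {d : J → ℕ}
    (h : ∀ j, HasParity σ (d j) (A j)) (l : List J) :
    HasParity σ (l.map d).sum (l.map A).prod := by
  induction l with
  | nil => simpa using HasParity.one
  | cons a l ih => simpa using (h a).mul ih

theorem IsParity.commute_of_even (hσ : IsParity σ) {k : ℕ} {x : B} (hx : HasParity σ k x)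
    (hk : Even k) (y : B) : x * y = y * x := by
  -- The factor one half makes the symmetrization of the rescaled element equal to `x` itself.
  have h := hσ.even_comm ((2⁻¹ : ℝ) • x) y
  rw [map_smul, hx.even hk, ← add_smul] at h
  norm_num at h
  exact h

theorem IsParity.mul_comm_of_odd (hσ : IsParity σ) {k : ℕ} {x : B} (hx : HasParity σ k x)
    (hk : ¬ Even k) (y : B) : x * y = σ y * x := by
  have h := hσ.odd_comm ((2⁻¹ : ℝ) • x) y
  rw [map_smul, hx.odd hk, smul_neg, sub_neg_eq_add, ← add_smul] at h
  norm_num at h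
  exact h

/-- Moving an odd element past itself gives $x^2=-x^2$, and 2 is invertible. -/
theorem IsParity.mul_self_of_odd (hσ : IsParity σ) {k : ℕ} {x : B} (hx : HasParity σ k x)
    (hk : ¬ Even k) : x * x = 0 := by
  have h := hσ.mul_comm_of_odd hx hk x
  rw [hx.odd hk, neg_mul] at h
  have h2 : (2 : ℝ) • (x * x) = 0 := by rw [two_smul]; exact add_eq_zero_iff_eq_neg.2 h
  exact (smul_eq_zero.1 h2).resolve_left two_ne_zero

/-- `D` satisfies the Leibniz rule `D (x * y) = D x * φ y + ψ x * D y`. -/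
def SkewLeibniz {W : Type*} [Ring W] [Algebra ℝ W] (φ ψ : W →ₐ[ℝ] B) (D : W →ₗ[ℝ] B) : Prop :=
  ∀ x y, D (x * y) = D x * φ y + ψ x * D y

theorem SkewLeibniz.map_one {W : Type*} [Ring W] [Algebra ℝ W] {φ ψ : W →ₐ[ℝ] B}
    {D : W →ₗ[ℝ] B} (h : SkewLeibniz φ ψ D) : D 1 = 0 := by
  simpa using h 1 1

theorem SkewLeibniz.sum {W J : Type*} [Ring W] [Algebra ℝ W] {φ ψ : W →ₐ[ℝ] B} (s : Finset J)
    {D : J → W →ₗ[ℝ] B} (h : ∀ j ∈ s, SkewLeibniz φ ψ (D j)) :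
    SkewLeibniz φ ψ (∑ j ∈ s, D j) := by
  intro x y
  simp only [LinearMap.sum_apply, Finset.sum_mul, Finset.mul_sum, ← Finset.sum_add_distrib]
  exact Finset.sum_congr rfl fun j hj => h j hj x y

theorem SkewLeibniz.neg {W : Type*} [Ring W] [Algebra ℝ W] {φ ψ : W →ₐ[ℝ] B}
    {D : W →ₗ[ℝ] B} (h : SkewLeibniz φ ψ D) : SkewLeibniz φ ψ (-D) := by
  intro x y
  simp only [LinearMap.neg_apply, h x y]
  noncomm_ring

/-- An odd element times an even derivation is an odd derivation. -/
theorem SkewLeibniz.mulLeft_odd (hσ : IsParity σ) {D : B →ₗ[ℝ] B}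
    (h : SkewLeibniz (AlgHom.id ℝ B) (AlgHom.id ℝ B) D) {k : ℕ} {v : B} (hv : HasParity σ k v)
    (hk : ¬ Even k) : SkewLeibniz (AlgHom.id ℝ B) σ (LinearMap.mulLeft ℝ v ∘ₗ D) := by
  intro x y
  simp only [LinearMap.comp_apply, LinearMap.mulLeft_apply, h x y, AlgHom.id_apply, mul_add,
    ← mul_assoc, hσ.mul_comm_of_odd hv hk x]

/-- An even element times an odd derivation is an odd derivation. -/
theorem SkewLeibniz.mulLeft_even (hσ : IsParity σ) {D : B →ₗ[ℝ] B}
    (h : SkewLeibniz (AlgHom.id ℝ B) σ D) {k : ℕ} {v : B} (hv : HasParity σ k v)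
    (hk : Even k) : SkewLeibniz (AlgHom.id ℝ B) σ (LinearMap.mulLeft ℝ v ∘ₗ D) := by
  intro x y
  simp only [LinearMap.comp_apply, LinearMap.mulLeft_apply, h x y, AlgHom.id_apply, mul_add,
    ← mul_assoc, hσ.commute_of_even hv hk (σ x)]

end Parity

/-! ### Parity and contraction in the exterior algebra -/

section Exterior

variable {M : Type*} [AddCommGroup M] [Module ℝ M]

/-- The grading automorphism of the exterior algebra. -/
def extParity (M : Type*) [AddCommGroup M] [Module ℝ M] :
    ExteriorAlgebra ℝ M →ₐ[ℝ] ExteriorAlgebra ℝ M :=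
  CliffordAlgebra.involute

theorem extParity_ι (v : M) : extParity M (ExteriorAlgebra.ι ℝ v) = -ExteriorAlgebra.ι ℝ v :=
  CliffordAlgebra.involute_ι v

/-- A covector anticommutes with covectors, so passing it through a product applies the grading
automorphism; both sides are multiplicative in `y`. -/
theorem ι_mul_eq_parity (v : M) (y : ExteriorAlgebra ℝ M) :
    ExteriorAlgebra.ι ℝ v * y = extParity M y * ExteriorAlgebra.ι ℝ v := by
  induction y using ExteriorAlgebra.induction with
  | algebraMap r => rw [AlgHom.commutes, Algebra.commutes]
  | ι w => rw [extParity_ι, neg_mul, eq_neg_iff_add_eq_zero, ExteriorAlgebra.ι_add_mul_swap]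
  | mul a b ha hb => rw [← mul_assoc, ha, mul_assoc, hb, ← mul_assoc, map_mul]
  | add a b ha hb => rw [mul_add, ha, hb, map_add, add_mul]

theorem isParity_ext : IsParity (extParity M) := by
  have invol : ∀ x, extParity M (extParity M x) = x := CliffordAlgebra.involute_involutive
  -- Both statements are needed in one induction: left multiplication by a covector exchanges even
  -- and odd parts, so each case for `ι v * x` uses the other statement for `x`.
  have h : ∀ x : ExteriorAlgebra ℝ M,
      (∀ y, (x + extParity M x) * y = y * (x + extParity M x)) ∧
      ∀ y, (x - extParity M x) * y = extParity M y * (x - extParity M x) := by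
    intro x
    induction x using CliffordAlgebra.left_induction with
    | algebraMap r =>
      have : extParity M (algebraMap ℝ _ r) = algebraMap ℝ _ r := AlgHom.commutes _ r
      refine ⟨fun y => ?_, fun y => ?_⟩
      · rw [this, ← map_add]; exact Algebra.commutes _ _
      · rw [this, sub_self, zero_mul, mul_zero]
    | add x z hx hz =>
      refine ⟨fun y => ?_, fun y => ?_⟩
      · rw [map_add, add_add_add_comm, add_mul, hx.1, hz.1, ← mul_add]
      · rw [map_add, add_sub_add_comm, add_mul, hx.2, hz.2, mul_add]
    | ι_mul x v hx =>
      have e : extParity M (ExteriorAlgebra.ι ℝ v * x) =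
          -(ExteriorAlgebra.ι ℝ v * extParity M x) := by
        rw [map_mul, extParity_ι, neg_mul]
      change (∀ y, (ExteriorAlgebra.ι ℝ v * x + extParity M (ExteriorAlgebra.ι ℝ v * x)) * y =
        y * (ExteriorAlgebra.ι ℝ v * x + extParity M (ExteriorAlgebra.ι ℝ v * x))) ∧
        ∀ y, (ExteriorAlgebra.ι ℝ v * x - extParity M (ExteriorAlgebra.ι ℝ v * x)) * y =
        extParity M y * (ExteriorAlgebra.ι ℝ v * x - extParity M (ExteriorAlgebra.ι ℝ v * x))
      rw [e, ← sub_eq_add_neg, sub_neg_eq_add, ← mul_sub, ← mul_add]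
      refine ⟨fun y => ?_, fun y => ?_⟩
      · rw [mul_assoc, hx.2, ← mul_assoc, ι_mul_eq_parity, invol, mul_assoc]
      · rw [mul_assoc, hx.1, ← mul_assoc, ι_mul_eq_parity, mul_assoc]
  exact ⟨invol, fun x => (h x).1, fun x => (h x).2⟩

theorem hasParity_of_mem_exteriorPower {k : ℕ} {x : ExteriorAlgebra ℝ M}
    (hx : x ∈ ⋀[ℝ]^k M) : HasParity (extParity M) k x := by
  induction hx using Submodule.pow_induction_on_left' with
  | algebraMap r => simp [HasParity]
  | add x y i _ _ hx hy => exact hx.add hy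
  | mem_mul v hv i x _ hx =>
    obtain ⟨v, rfl⟩ := hv
    rw [Nat.succ_eq_add_one, add_comm]
    exact HasParity.mul (by simp [HasParity, extParity_ι]) hx

/-- Contraction with a covector as an odd derivation. -/
theorem contractLeft_skewLeibniz (d : Module.Dual ℝ M) :
    SkewLeibniz (AlgHom.id ℝ (ExteriorAlgebra ℝ M)) (extParity M)
      (CliffordAlgebra.contractLeft (Q := 0) d) := by
  intro x y
  induction x using CliffordAlgebra.left_induction with
  | algebraMap r =>
    have : extParity M (algebraMap ℝ _ r) = algebraMap ℝ _ r := AlgHom.commutes _ r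
    rw [CliffordAlgebra.contractLeft_algebraMap_mul, CliffordAlgebra.contractLeft_algebraMap,
      zero_mul, zero_add]
    exact congrArg (· * _) this.symm
  | add x z hx hz => rw [add_mul, map_add, hx, hz, map_add, map_add, add_mul, add_mul]; abel
  | ι_mul x v hx =>
    rw [mul_assoc, CliffordAlgebra.contractLeft_ι_mul, hx, CliffordAlgebra.contractLeft_ι_mul,
      map_mul]
    change _ = _ + extParity M (ExteriorAlgebra.ι ℝ v) * _ * _
    rw [extParity_ι]
    change _ • _ - ExteriorAlgebra.ι ℝ v * _ = (_ • _ - ExteriorAlgebra.ι ℝ v * _) * _ + _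
    simp only [AlgHom.id_apply, sub_mul, mul_add, smul_mul_assoc, neg_mul, mul_assoc]
    abel

end Exterior

/-! ### Extending parity and derivations to tensor products -/

section Tensor

variable {C : Type*} [CommRing C] [Algebra ℝ C] {B : Type*} [Ring B] [Algebra ℝ B]

/-- The extension of a grading automorphism by the identity on a tensor factor. -/
def tensorParity (C : Type*) [CommRing C] [Algebra ℝ C] (σ : B →ₐ[ℝ] B) :
    C ⊗[ℝ] B →ₐ[ℝ] C ⊗[ℝ] B :=
  Algebra.TensorProduct.map (AlgHom.id ℝ C) σ

variable {σ : B →ₐ[ℝ] B}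

@[simp] theorem tensorParity_tmul (c : C) (b : B) :
    tensorParity C σ (c ⊗ₜ b) = c ⊗ₜ σ b := rfl

theorem IsParity.tensor (hσ : IsParity σ) : IsParity (tensorParity C σ) := by
  refine ⟨fun x => ?_, fun x y => ?_, fun x y => ?_⟩
  · induction x using TensorProduct.induction_on with
    | zero => simp
    | tmul c b => simp [hσ.invol]
    | add x y hx hy => rw [map_add, map_add, hx, hy]
  · induction x using TensorProduct.induction_on with
    | zero => simp
    | add x z hx hz => rw [map_add, add_add_add_comm, add_mul, hx, hz, ← mul_add]
    | tmul c b =>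
      induction y using TensorProduct.induction_on with
      | zero => simp
      | add y z hy hz => rw [mul_add, hy, hz, add_mul]
      | tmul c' b' =>
        rw [tensorParity_tmul, ← TensorProduct.tmul_add, Algebra.TensorProduct.tmul_mul_tmul,
          Algebra.TensorProduct.tmul_mul_tmul, hσ.even_comm, mul_comm]
  · induction x using TensorProduct.induction_on with
    | zero => simp
    | add x z hx hz => rw [map_add, add_sub_add_comm, add_mul, hx, hz, mul_add]
    | tmul c b =>
      induction y using TensorProduct.induction_on with
      | zero => simp
      | add y z hy hz => rw [mul_add, hy, hz, map_add, add_mul]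
      | tmul c' b' =>
        rw [tensorParity_tmul, ← TensorProduct.tmul_sub, Algebra.TensorProduct.tmul_mul_tmul,
          tensorParity_tmul, Algebra.TensorProduct.tmul_mul_tmul, hσ.odd_comm, mul_comm]

/-- The factor `C` is purely even, so `D` passes it without a sign. -/
theorem SkewLeibniz.tensor_right {D : B →ₗ[ℝ] B} (h : SkewLeibniz (AlgHom.id ℝ B) σ D) :
    SkewLeibniz (AlgHom.id ℝ (C ⊗[ℝ] B)) (tensorParity C σ)
      (TensorProduct.map LinearMap.id D) := by
  intro x y
  induction x using TensorProduct.induction_on with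
  | zero => simp
  | add x z hx hz => rw [add_mul, map_add, hx, hz, map_add, map_add, add_mul, add_mul]; abel
  | tmul c b =>
    induction y using TensorProduct.induction_on with
    | zero => simp
    | add y z hy hz =>
      rw [mul_add, map_add, hy, hz, map_add, map_add, mul_add, mul_add]; abel
    | tmul c' b' =>
      simp [TensorProduct.map_tmul, h b b', TensorProduct.tmul_add]

theorem tensorParity_id : tensorParity C (AlgHom.id ℝ B) = AlgHom.id ℝ _ := by
  simp [tensorParity]

theorem SkewLeibniz.tensor_left {D : C →ₗ[ℝ] C}
    (h : SkewLeibniz (AlgHom.id ℝ C) (AlgHom.id ℝ C) D) :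
    SkewLeibniz (AlgHom.id ℝ (C ⊗[ℝ] B)) (AlgHom.id ℝ _)
      (TensorProduct.map D LinearMap.id) := by
  intro x y
  induction x using TensorProduct.induction_on with
  | zero => simp
  | add x z hx hz => rw [add_mul, map_add, hx, hz, map_add, map_add, add_mul, add_mul]; abel
  | tmul c b =>
    induction y using TensorProduct.induction_on with
    | zero => simp
    | add y z hy hz =>
      rw [mul_add, map_add, hy, hz, map_add, map_add, mul_add, mul_add]; abel
    | tmul c' b' =>
      simp [TensorProduct.map_tmul, h c c', TensorProduct.add_tmul]

end Tensor

/-! ### Partial derivatives of smooth functions -/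

section SmoothFunctions

variable {n : ℕ} {U : Opens (Euc n)}

theorem two_le_infty : (2 : WithTop ℕ∞) ≤ ∞ :=
  WithTop.coe_le_coe.2 (le_top : (2 : ℕ∞) ≤ ⊤)

theorem SmoothFun.ext {f g : SmoothFun U} (h : ∀ x : U, f.1 x = g.1 x) : f = g :=
  Subtype.ext (funext h)

theorem pd_apply (i : Fin n) (f : SmoothFun U) (x : U) :
    (pd U i f).1 x = fderiv ℝ (extendZero f.1) (x : Euc n) (EuclideanSpace.single i 1) := rfl

theorem extendZero_eventuallyEq {f : SmoothFun U} {g : Euc n → ℝ} (h : ∀ x : U, f.1 x = g x)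
    (x : U) : extendZero f.1 =ᶠ[nhds (x : Euc n)] g := by
  filter_upwards [U.isOpen.mem_nhds x.2] with y hy
  rw [extendZero_apply f.1 ⟨y, hy⟩, h ⟨y, hy⟩]

theorem pd_apply_of_eq {f : SmoothFun U} {g : Euc n → ℝ} (h : ∀ x : U, f.1 x = g x)
    (i : Fin n) (x : U) :
    (pd U i f).1 x = fderiv ℝ g (x : Euc n) (EuclideanSpace.single i 1) := by
  rw [pd_apply, (extendZero_eventuallyEq h x).fderiv_eq]

theorem pd_mul (i : Fin n) (f g : SmoothFun U) : pd U i (f * g) = pd U i f * g + f * pd U i g := by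
  refine SmoothFun.ext fun x => ?_
  have h : ∀ y : U, (f * g).1 y = (fun z => extendZero f.1 z * extendZero g.1 z) y := fun y => by
    change f.1 y * g.1 y = extendZero f.1 y * extendZero g.1 y
    rw [extendZero_apply, extendZero_apply]
  rw [pd_apply_of_eq (g := fun z => extendZero f.1 z * extendZero g.1 z) h,
    fderiv_fun_mul (extendZero_differentiableAt f x) (extendZero_differentiableAt g x)]
  change _ = (pd U i f).1 x * g.1 x + f.1 x * (pd U i g).1 x
  rw [pd_apply, pd_apply, ← extendZero_apply f.1, ← extendZero_apply g.1]
  simp only [add_apply, smul_apply, smul_eq_mul]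
  ring

theorem pd_skewLeibniz (i : Fin n) :
    SkewLeibniz (AlgHom.id ℝ (SmoothFun U)) (AlgHom.id ℝ _) (pd U i) :=
  fun f g => pd_mul i f g

theorem pd_xcoord (i j : Fin n) : pd U i (xcoord U j) = if i = j then 1 else 0 := by
  refine SmoothFun.ext fun x => ?_
  rw [pd_apply_of_eq (g := EuclideanSpace.proj (𝕜 := ℝ) j) fun y => rfl,
    ContinuousLinearMap.fderiv]
  split_ifs with h
  · subst h
    change _ = (1 : ℝ)
    simp
  · change _ = (0 : ℝ)
    simp [Ne.symm h]

/-- Schwarz's theorem: both orders are values of the second Fréchet derivative, which is symmetric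
at points of the open set. This symmetry is behind both $d^2=0$ and $Q^2f=0$. -/
theorem pd_comm (i j : Fin n) (f : SmoothFun U) : pd U i (pd U j f) = pd U j (pd U i f) := by
  refine SmoothFun.ext fun x => ?_
  have key : ∀ k l : Fin n, (pd U k (pd U l f)).1 x =
      fderiv ℝ (fderiv ℝ (extendZero f.1)) (x : Euc n) (EuclideanSpace.single k 1)
        (EuclideanSpace.single l 1) := by
    intro k l
    rw [pd_apply_of_eq (g := fun z => fderiv ℝ (extendZero f.1) z (EuclideanSpace.single l 1))
      fun y => rfl]
    have hd : DifferentiableAt ℝ (fderiv ℝ (extendZero f.1)) (x : Euc n) :=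
      (((extendZero_contDiffOn f).fderiv_of_isOpen (m := 1) U.isOpen
        (by simpa [one_add_one_eq_two] using two_le_infty)).differentiableOn one_ne_zero).differentiableAt (U.isOpen.mem_nhds x.2)
    rw [fderiv_clm_apply hd (differentiableAt_const _)]
    simp
  rw [key, key]
  have hf : ContDiffAt ℝ ∞ (extendZero f.1) (x : Euc n) :=
    (extendZero_contDiffOn f).contDiffAt (U.isOpen.mem_nhds x.2)
  exact (hf.isSymmSndFDerivAt (by simpa using two_le_infty)).eq _ _

end SmoothFunctions

/-! ### Functions on a graded manifold: generators, substitution, vector fields -/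

section Graded

variable {n : ℕ} {κ : Type*} {U : Opens (Euc n)} {deg : κ → ℕ}

/-- The grading automorphism of the functions on the graded manifold. -/
def gradedParity (U : Opens (Euc n)) (deg : κ → ℕ) : GradedFun U deg →ₐ[ℝ] GradedFun U deg :=
  tensorParity _ (tensorParity _ (extParity _))

theorem isParity_graded : IsParity (gradedParity U deg) := isParity_ext.tensor.tensor

/-- `baseFun` as an algebra homomorphism. -/
def baseHom (U : Opens (Euc n)) (deg : κ → ℕ) : SmoothFun U →ₐ[ℝ] GradedFun U deg :=
  Algebra.TensorProduct.includeLeft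

theorem baseHom_apply (f : SmoothFun U) : baseHom U deg f = baseFun U deg f := rfl

theorem gradedParity_baseFun (f : SmoothFun U) :
    gradedParity U deg (baseFun U deg f) = baseFun U deg f := by
  simp [gradedParity, baseFun]

theorem hasParity_baseFun (f : SmoothFun U) :
    HasParity (gradedParity U deg) 0 (baseFun U deg f) :=
  .of_even (by simp) (gradedParity_baseFun f)

theorem hasParity_coord (a : κ) :
    HasParity (gradedParity U deg) (deg a) (coord U deg a) := by
  by_cases h : Even (deg a)
  · refine .of_even h ?_
    simp [gradedParity, coord, h]
  · refine .of_odd h ?_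
    simp [gradedParity, coord, h, extParity_ι, TensorProduct.tmul_neg]

-- The algebra is generated by base functions and coordinates, real scalars being constant base
-- functions. Identities between homomorphisms or derivations can therefore be checked on these
-- generators.
@[elab_as_elim]
theorem gradedFun_induction {p : GradedFun U deg → Prop} (base : ∀ f, p (baseFun U deg f))
    (coord : ∀ a, p (coord U deg a)) (add : ∀ x y, p x → p y → p (x + y))
    (mul : ∀ x y, p x → p y → p (x * y)) (x : GradedFun U deg) : p x := by
  have scalar : ∀ r : ℝ, p (algebraMap ℝ _ r) := fun r => by
    have := base (algebraMap ℝ _ r)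
    rwa [← baseHom_apply, AlgHom.commutes] at this
  have zero : p 0 := by simpa using scalar 0
  have poly : ∀ P : MvPolynomial {a : κ // Even (deg a)} ℝ,
      p (1 ⊗ₜ ((show EvenPoly _ from P) ⊗ₜ 1)) := by
    intro P
    induction P using MvPolynomial.induction_on with
    | C r =>
      convert scalar r using 1
      rw [Algebra.TensorProduct.algebraMap_apply', Algebra.TensorProduct.algebraMap_apply]
      rfl
    | add P Q hP hQ =>
      have := add _ _ hP hQ
      rw [← TensorProduct.tmul_add, ← TensorProduct.add_tmul] at this
      exact this
    | mul_X P a hP =>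
      have h1 : HigherGauge.coord U deg a = 1 ⊗ₜ (EvenPoly.X a ⊗ₜ 1) := by
        simp [HigherGauge.coord, a.2]
      have := mul _ _ hP (h1 ▸ coord a)
      rw [Algebra.TensorProduct.tmul_mul_tmul, Algebra.TensorProduct.tmul_mul_tmul, one_mul,
        one_mul] at this
      exact this
  have ext : ∀ u : ExteriorAlgebra ℝ ({a : κ // ¬ Even (deg a)} →₀ ℝ),
      p (1 ⊗ₜ (1 ⊗ₜ u)) := by
    intro u
    induction u using ExteriorAlgebra.induction with
    | algebraMap r =>
      convert scalar r using 1
      rw [Algebra.TensorProduct.algebraMap_apply', Algebra.TensorProduct.algebraMap_apply']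
    | ι v =>
      induction v using Finsupp.induction_linear with
      | zero => simpa using zero
      | add v w hv hw =>
        have := add _ _ hv hw
        rwa [← TensorProduct.tmul_add, ← TensorProduct.tmul_add, ← map_add] at this
      | single a r =>
        have h1 : HigherGauge.coord U deg a =
            1 ⊗ₜ (1 ⊗ₜ ExteriorAlgebra.ι ℝ (Finsupp.single a 1)) := by
          simp [HigherGauge.coord, a.2]
        have := mul _ _ (scalar r) (h1 ▸ coord a)
        rwa [← Algebra.smul_def, ← TensorProduct.tmul_smul, ← TensorProduct.tmul_smul, ← map_smul,
          Finsupp.smul_single, smul_eq_mul, mul_one] at this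
    | add u v hu hv =>
      have := add _ _ hu hv
      rwa [← TensorProduct.tmul_add, ← TensorProduct.tmul_add] at this
    | mul u v hu hv =>
      have := mul _ _ hu hv
      simpa only [Algebra.TensorProduct.tmul_mul_tmul, one_mul] using this
  have fiber : ∀ z, p (1 ⊗ₜ z) := by
    intro z
    induction z using TensorProduct.induction_on with
    | zero => simpa using zero
    | add z w hz hw =>
      have := add _ _ hz hw
      rwa [← TensorProduct.tmul_add] at this
    | tmul P u =>
      have := mul _ _ (poly P) (ext u)
      simpa only [Algebra.TensorProduct.tmul_mul_tmul, one_mul, mul_one] using this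
  induction x using TensorProduct.induction_on with
  | zero => exact zero
  | add x y hx hy => exact add _ _ hx hy
  | tmul f z =>
    have := mul _ _ (base f) (fiber z)
    simpa only [baseFun, Algebra.TensorProduct.tmul_mul_tmul, one_mul, mul_one] using this

section Hom

variable {B : Type*} [Ring B] [Algebra ℝ B]

theorem gradedFun_hom_ext {φ ψ : GradedFun U deg →ₐ[ℝ] B}
    (base : ∀ f, φ (baseFun U deg f) = ψ (baseFun U deg f))
    (hcoord : ∀ a, φ (coord U deg a) = ψ (coord U deg a)) : φ = ψ := by
  refine AlgHom.ext fun x => ?_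
  induction x using gradedFun_induction with
  | base f => exact base f
  | coord a => exact hcoord a
  | add x y hx hy => rw [map_add, map_add, hx, hy]
  | mul x y hx hy => rw [map_mul, map_mul, hx, hy]

/-- The Leibniz rule determines a derivation on products from its values on the factors, provided
both derivations twist by the same homomorphisms. -/
theorem SkewLeibniz.ext_graded {φ ψ : GradedFun U deg →ₐ[ℝ] B} {D E : GradedFun U deg →ₗ[ℝ] B}
    (hD : SkewLeibniz φ ψ D) (hE : SkewLeibniz φ ψ E)
    (base : ∀ f, D (baseFun U deg f) = E (baseFun U deg f))
    (hcoord : ∀ a, D (coord U deg a) = E (coord U deg a)) : D = E := by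
  refine LinearMap.ext fun x => ?_
  induction x using gradedFun_induction with
  | base f => exact base f
  | coord a => exact hcoord a
  | add x y hx hy => rw [map_add, map_add, hx, hy]
  | mul x y hx hy => rw [hD, hE, hx, hy]

/-- Evaluation of polynomials in a commutative algebra. -/
def EvenPoly.aeval {J R : Type*} [CommRing R] [Algebra ℝ R] (g : J → R) : EvenPoly J →ₐ[ℝ] R :=
  (MvPolynomial.aeval g : MvPolynomial J ℝ →ₐ[ℝ] R)

theorem EvenPoly.aeval_X {J R : Type*} [CommRing R] [Algebra ℝ R] (g : J → R) (j : J) :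
    EvenPoly.aeval g (EvenPoly.X j) = g j :=
  MvPolynomial.aeval_X (R := ℝ) g j

variable {σ : B →ₐ[ℝ] B}

/-- Substitution of even elements of a supercommutative algebra into polynomials. -/
def evenLift (hσ : IsParity σ) (A : κ → B) (hA : ∀ a, HasParity σ (deg a) (A a)) :
    EvenPoly {a : κ // Even (deg a)} →ₐ[ℝ] B :=
  (Subalgebra.center ℝ B).val.comp
    (EvenPoly.aeval fun a => (⟨A a, Subalgebra.mem_center_iff.2
      fun b => (hσ.commute_of_even (hA a) a.2 b).symm⟩ : Subalgebra.center ℝ B))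

theorem evenLift_X (hσ : IsParity σ) (A : κ → B) (hA : ∀ a, HasParity σ (deg a) (A a))
    (a : {a : κ // Even (deg a)}) : evenLift hσ A hA (EvenPoly.X a) = A a := by
  rw [evenLift, AlgHom.comp_apply, EvenPoly.aeval_X]
  rfl

theorem evenLift_commute (hσ : IsParity σ) (A : κ → B)
    (hA : ∀ a, HasParity σ (deg a) (A a)) (P : EvenPoly {a : κ // Even (deg a)}) (b : B) :
    Commute (evenLift hσ A hA P) b :=
  (Subalgebra.mem_center_iff.1 (Subtype.prop _) _).symm

/-- Substitution of odd elements of a supercommutative algebra for odd variables. -/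
def oddLift (hσ : IsParity σ) (A : κ → B) (hA : ∀ a, HasParity σ (deg a) (A a)) :
    ExteriorAlgebra ℝ ({a : κ // ¬ Even (deg a)} →₀ ℝ) →ₐ[ℝ] B :=
  ExteriorAlgebra.lift ℝ
    ⟨Finsupp.linearCombination ℝ fun a : {a : κ // ¬ Even (deg a)} => A a, fun v => by
      refine hσ.mul_self_of_odd (k := 1) ?_ (by simp)
      induction v using Finsupp.induction_linear with
      | zero => simpa using HasParity.zero 1
      | add v w hv hw => rw [map_add]; exact hv.add hw
      | single a r =>
        rw [Finsupp.linearCombination_single]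
        exact HasParity.smul r (.of_odd (by simp) ((hA a).odd a.2))⟩

theorem oddLift_ι (hσ : IsParity σ) (A : κ → B) (hA : ∀ a, HasParity σ (deg a) (A a))
    (a : {a : κ // ¬ Even (deg a)}) :
    oddLift hσ A hA (ExteriorAlgebra.ι ℝ (Finsupp.single a 1)) = A a := by
  simp [oddLift]

/-- The substitution homomorphism from the functions on a graded manifold to a supercommutative
algebra. -/
def gradedLift (hσ : IsParity σ) (φ : SmoothFun U →ₐ[ℝ] B) (hφ : ∀ f, HasParity σ 0 (φ f))
    (A : κ → B) (hA : ∀ a, HasParity σ (deg a) (A a)) : GradedFun U deg →ₐ[ℝ] B :=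
  Algebra.TensorProduct.lift φ
    (Algebra.TensorProduct.lift (evenLift hσ A hA) (oddLift hσ A hA)
      fun _ _ => evenLift_commute hσ A hA _ _)
    fun f _ => show Commute _ _ from hσ.commute_of_even (hφ f) (by simp) _

variable (hσ : IsParity σ) (φ : SmoothFun U →ₐ[ℝ] B) (hφ : ∀ f, HasParity σ 0 (φ f))
  (A : κ → B) (hA : ∀ a, HasParity σ (deg a) (A a))

theorem gradedLift_baseFun (f : SmoothFun U) :
    gradedLift hσ φ hφ A hA (baseFun U deg f) = φ f := by
  refine (Algebra.TensorProduct.lift_tmul _ _ _ _ _).trans ?_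
  rw [map_one, mul_one]

theorem gradedLift_coord (a : κ) :
    gradedLift hσ φ hφ A hA (coord U deg a) = A a := by
  by_cases h : Even (deg a)
  · rw [coord, dif_pos h]
    refine (Algebra.TensorProduct.lift_tmul _ _ _ _ _).trans ?_
    rw [map_one, one_mul, Algebra.TensorProduct.lift_tmul, map_one, mul_one, evenLift_X]
  · rw [coord, dif_neg h]
    refine (Algebra.TensorProduct.lift_tmul _ _ _ _ _).trans ?_
    rw [map_one, one_mul, Algebra.TensorProduct.lift_tmul, map_one, one_mul, oddLift_ι]

theorem gradedLift_parity (x : GradedFun U deg) :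
    gradedLift hσ φ hφ A hA (gradedParity U deg x) = σ (gradedLift hσ φ hφ A hA x) := by
  induction x using gradedFun_induction with
  | base f => rw [gradedParity_baseFun, gradedLift_baseFun, (hφ f).even (by simp)]
  | coord a => rw [hasParity_coord, map_smul, gradedLift_coord, hA a]
  | add x y hx hy => simp only [map_add, hx, hy]
  | mul x y hx hy => simp only [map_mul, hx, hy]

end Hom

section VectorFields

theorem pderiv_skewLeibniz {J : Type*} (a : J) :
    SkewLeibniz (AlgHom.id ℝ (EvenPoly J)) (AlgHom.id ℝ _) (EvenPoly.pderiv a) := by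
  intro x y
  have := (MvPolynomial.pderiv (R := ℝ) a).leibniz x y
  change MvPolynomial.pderiv (R := ℝ) a _ = _
  refine this.trans ((add_comm _ _).trans ?_)
  exact congrArg₂ (· + ·) (mul_comm (G := MvPolynomial J ℝ) _ _) rfl

theorem partialD_inl_skewLeibniz (i : Fin n) :
    SkewLeibniz (AlgHom.id ℝ (GradedFun U deg)) (AlgHom.id ℝ _) (partialD U deg (.inl i)) :=
  (pd_skewLeibniz i).tensor_left

theorem partialD_inr_skewLeibniz_of_even {a : κ} (h : Even (deg a)) :
    SkewLeibniz (AlgHom.id ℝ (GradedFun U deg)) (AlgHom.id ℝ _) (partialD U deg (.inr a)) := by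
  have := (pderiv_skewLeibniz (⟨a, h⟩ : {a : κ // Even (deg a)})).tensor_left
    (B := ExteriorAlgebra ℝ ({a : κ // ¬ Even (deg a)} →₀ ℝ))
  have := this.tensor_right (C := SmoothFun U)
  rw [tensorParity_id] at this
  simpa only [partialD, h, dif_pos] using this

theorem partialD_inr_skewLeibniz_of_odd {a : κ} (h : ¬ Even (deg a)) :
    SkewLeibniz (AlgHom.id ℝ (GradedFun U deg)) (gradedParity U deg)
      (partialD U deg (.inr a)) := by
  have := ((contractLeft_skewLeibniz (Finsupp.lapply (R := ℝ)
    (⟨a, h⟩ : {a : κ // ¬ Even (deg a)}))).tensor_right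
    (C := EvenPoly {a : κ // Even (deg a)})).tensor_right (C := SmoothFun U)
  rw [partialD, dif_neg h]
  exact this

theorem partialD_inl_baseFun (i : Fin n) (f : SmoothFun U) :
    partialD U deg (.inl i) (baseFun U deg f) = baseFun U deg (pd U i f) := by
  simp [partialD, baseFun]

theorem partialD_inl_coord (i : Fin n) (a : κ) :
    partialD U deg (.inl i) (coord U deg a) = 0 := by
  have : pd U i 1 = 0 := (pd_skewLeibniz i).map_one
  by_cases h : Even (deg a) <;> simp [partialD, coord, h, this]

theorem partialD_inr_baseFun (a : κ) (f : SmoothFun U) :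
    partialD U deg (.inr a) (baseFun U deg f) = 0 := by
  by_cases h : Even (deg a)
  · have : EvenPoly.pderiv (⟨a, h⟩ : {a : κ // Even (deg a)}) 1 = 0 :=
      (pderiv_skewLeibniz _).map_one
    simp [partialD, baseFun, h, this, Algebra.TensorProduct.one_def]
  · simp [partialD, baseFun, h, Algebra.TensorProduct.one_def]

open Classical in
theorem partialD_inr_coord (a b : κ) :
    partialD U deg (.inr a) (coord U deg b) = if a = b then 1 else 0 := by
  by_cases ha : Even (deg a) <;> by_cases hb : Even (deg b)
  · have : EvenPoly.pderiv (⟨a, ha⟩ : {a : κ // Even (deg a)}) (EvenPoly.X ⟨b, hb⟩) =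
        if a = b then 1 else 0 := by
      refine (MvPolynomial.pderiv_X (R := ℝ) _ _).trans ?_
      simp only [Pi.single_apply, Subtype.mk.injEq, eq_comm]
      rfl
    by_cases hab : a = b
    · subst hab
      simp [partialD, coord, ha, this, Algebra.TensorProduct.one_def]
    · simp [partialD, coord, ha, hb, this, hab]
  · have hab : a ≠ b := fun h => hb (h ▸ ha)
    have : EvenPoly.pderiv (⟨a, ha⟩ : {a : κ // Even (deg a)}) 1 = 0 :=
      (pderiv_skewLeibniz _).map_one
    simp [partialD, coord, ha, hb, hab, this]
  · have hab : a ≠ b := fun h => ha (h ▸ hb)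
    simp [partialD, coord, ha, hb, hab]
  · have : CliffordAlgebra.contractLeft (Q := (0 : QuadraticForm ℝ
        ({a : κ // ¬ Even (deg a)} →₀ ℝ))) (Finsupp.lapply (R := ℝ) ⟨a, ha⟩)
        (ExteriorAlgebra.ι ℝ (Finsupp.single ⟨b, hb⟩ 1)) = if a = b then 1 else 0 := by
      rw [ExteriorAlgebra.ι, CliffordAlgebra.contractLeft_ι]
      by_cases hab : a = b
      · subst hab; simp
      · simp [hab]
    by_cases hab : a = b
    · subst hab
      simp only [partialD, coord, ha, dif_neg, not_false_eq_true, TensorProduct.map_tmul,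
        LinearMap.id_apply, this, if_true]
      rfl
    · simp only [partialD, coord, ha, hb, dif_neg, not_false_eq_true, TensorProduct.map_tmul,
        LinearMap.id_apply, this, if_neg hab, TensorProduct.tmul_zero]

variable [Fintype κ]

/-- The component along $q^\alpha$ has parity opposite to $q^\alpha$. Each summand is thus an odd
element times an even derivation or an even element times an odd one, and is an odd derivation
either way. -/
theorem vectorField_skewLeibniz (V : Fin n ⊕ κ → GradedFun U deg)
    (hV : ∀ α, HasParity (gradedParity U deg) (fieldDeg n deg α + 1) (V α)) :
    SkewLeibniz (AlgHom.id ℝ (GradedFun U deg)) (gradedParity U deg) (vectorField U deg V) := by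
  refine SkewLeibniz.sum _ fun α _ => ?_
  rcases α with i | a
  · exact (partialD_inl_skewLeibniz i).mulLeft_odd isParity_graded (hV _) (by simp [fieldDeg])
  · by_cases h : Even (deg a)
    · exact (partialD_inr_skewLeibniz_of_even h).mulLeft_odd isParity_graded (hV _)
        (by simpa [fieldDeg, Nat.even_add_one] using h)
    · exact (partialD_inr_skewLeibniz_of_odd h).mulLeft_even isParity_graded (hV _)
        (by simpa [fieldDeg, Nat.even_add_one] using h)

theorem vectorField_baseFun (V : Fin n ⊕ κ → GradedFun U deg) (f : SmoothFun U) :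
    vectorField U deg V (baseFun U deg f) = ∑ i, V (.inl i) * baseFun U deg (pd U i f) := by
  simp [vectorField, partialD_inl_baseFun, partialD_inr_baseFun]

theorem vectorField_coord (V : Fin n ⊕ κ → GradedFun U deg) (a : κ) :
    vectorField U deg V (coord U deg a) = V (.inr a) := by
  classical
  simp [vectorField, partialD_inl_coord, partialD_inr_coord]

theorem vectorField_xcoord (V : Fin n ⊕ κ → GradedFun U deg) (i : Fin n) :
    vectorField U deg V (baseFun U deg (xcoord U i)) = V (.inl i) := by
  have h1 : baseFun U deg 1 = 1 := map_one (baseHom U deg)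
  have h0 : baseFun U deg 0 = 0 := map_zero (baseHom U deg)
  simp [vectorField_baseFun, pd_xcoord, apply_ite (baseFun U deg), h0, h1]

end VectorFields

end Graded

theorem mul_sub_mul_eq {R : Type*} [Ring R] (x y a b : R) : x * y - a * b = (x - a) * y + a * (y - b) := by
  noncomm_ring

/-! ### Odd derivations: composition and squares -/

section Comp

variable {W W' B B' : Type*} [Ring W] [Algebra ℝ W] [Ring W'] [Algebra ℝ W'] [Ring B]
  [Algebra ℝ B] [Ring B'] [Algebra ℝ B']

theorem SkewLeibniz.comp_hom {φ ψ : W →ₐ[ℝ] B} {D : W →ₗ[ℝ] B} (h : SkewLeibniz φ ψ D)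
    (g : W' →ₐ[ℝ] W) : SkewLeibniz (φ.comp g) (ψ.comp g) (D ∘ₗ g.toLinearMap) := by
  intro x y
  simp [h (g x) (g y)]

theorem SkewLeibniz.hom_comp {φ ψ : W →ₐ[ℝ] B} {D : W →ₗ[ℝ] B} (h : SkewLeibniz φ ψ D)
    (g : B →ₐ[ℝ] B') : SkewLeibniz (g.comp φ) (g.comp ψ) (g.toLinearMap ∘ₗ D) := by
  intro x y
  simp [h x y]

theorem SkewLeibniz.mul_of_map_eq_zero {σ : B →ₐ[ℝ] B} {D : B →ₗ[ℝ] B}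
    (h : SkewLeibniz (AlgHom.id ℝ B) σ D) {k : ℕ} {v : B} (hv : HasParity σ k v) (hk : ¬ Even k)
    (h0 : D v = 0) (b : B) : D (v * b) = -(v * D b) := by
  rw [h, h0, zero_mul, zero_add, hv.odd hk, neg_mul]

theorem SkewLeibniz.anticomm_parity_mul {σ : B →ₐ[ℝ] B} {D : B →ₗ[ℝ] B}
    (h : SkewLeibniz (AlgHom.id ℝ B) σ D) {x y : B} (hx : D (σ x) = -σ (D x))
    (hy : D (σ y) = -σ (D y)) : D (σ (x * y)) = -σ (D (x * y)) := by
  rw [map_mul, h, h, hx, hy, map_add, map_mul, map_mul, AlgHom.id_apply, AlgHom.id_apply]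
  noncomm_ring

/-- The cross terms $\sigma(Dx)\,Dy$ and $D(\sigma x)\,Dy$ of $D^2(xy)$ cancel because $D$
anticommutes with the grading automorphism. -/
theorem SkewLeibniz.sq_mul {σ : B →ₐ[ℝ] B} {D : B →ₗ[ℝ] B}
    (h : SkewLeibniz (AlgHom.id ℝ B) σ D) (hσ : ∀ x, D (σ x) = -σ (D x)) {x y : B}
    (hx : D (D x) = 0) (hy : D (D y) = 0) : D (D (x * y)) = 0 := by
  rw [h, map_add, h, h, hx, hy, hσ]
  simp only [AlgHom.id_apply]
  noncomm_ring

/-- A form with values in odd elements is antisymmetric. -/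
theorem IsParity.sum_mul_symm_eq_zero {σ : B →ₐ[ℝ] B} (hσ : IsParity σ) {J : Type*} [Fintype J]
    {k : ℕ} {V : J → B} (hV : ∀ i, HasParity σ k (V i)) (hk : ¬ Even k) {g : J → J → B}
    (hg : ∀ i j, g i j = g j i) : ∑ i, ∑ j, V i * (V j * g j i) = 0 := by
  -- Renaming the indices and then exchanging the two odd factors shows that the sum equals its
  -- negative.
  have h : ∑ i, ∑ j, V i * (V j * g j i) = -∑ i, ∑ j, V i * (V j * g j i) := by
    conv_lhs => rw [Finset.sum_comm]
    rw [← Finset.sum_neg_distrib]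
    refine Finset.sum_congr rfl fun i _ => ?_
    rw [← Finset.sum_neg_distrib]
    refine Finset.sum_congr rfl fun j _ => ?_
    rw [← mul_assoc, hσ.mul_comm_of_odd (hV j) hk, (hV i).odd hk, hg, neg_mul, neg_mul, mul_assoc]
  have h3 : (2 : ℝ) • ∑ i, ∑ j, V i * (V j * g j i) = 0 := by
    rw [two_smul]; exact add_eq_zero_iff_eq_neg.2 h
  exact (smul_eq_zero.1 h3).resolve_left two_ne_zero

theorem HasParity.map_mul_odd {σ : B →ₐ[ℝ] B} {k : ℕ} {v : B} (hv : HasParity σ k v)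
    (hk : ¬ Even k) {b : B} (hb : σ b = b) : σ (v * b) = -(v * b) := by
  rw [map_mul, hb, hv.odd hk, neg_mul]

end Comp

/-! ### The polynomial part of the ansatz -/

section Poly

variable {n : ℕ} {ι : Type*} [Fintype ι] {U : Opens (Euc n)} {deg : ι → ℕ} (c : Ansatz U deg)
  {B : Type*} [Ring B] [Algebra ℝ B]

theorem Ansatz.map_poly {B' : Type*} [Ring B'] [Algebra ℝ B'] (ψ : B →ₐ[ℝ] B')
    (φ : SmoothFun U → B) (A : ι → B) (α : Fin n ⊕ ι) :
    ψ (c.poly φ A α) = c.poly (fun f => ψ (φ f)) (fun a => ψ (A a)) α := by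
  simp [Ansatz.poly, map_list_prod, List.map_ofFn, Function.comp_def]

/-- The polynomials of the ansatz are linear combinations of monomials of the correct degree. -/
theorem Ansatz.poly_mem {N : Submodule ℝ B} {φ : SmoothFun U → B} (hφ : φ 0 = 0) (A : ι → B)
    (α : Fin n ⊕ ι) (h : ∀ (f : SmoothFun U) (l : List ι),
      (l.map deg).sum = fieldDeg n deg α + 1 → φ f * (l.map A).prod ∈ N) :
    c.poly φ A α ∈ N := by
  refine N.sum_mem fun k _ => N.smul_mem _ (N.sum_mem fun β _ => ?_)
  by_cases hβ : ∑ j, deg (β j) = fieldDeg n deg α + 1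
  · have := h (c.coeff α k β) (List.ofFn β)
    rw [List.map_ofFn, List.map_ofFn, List.sum_ofFn] at this
    exact this hβ
  · rw [c.homogeneous α k β hβ, hφ, zero_mul]
    exact N.zero_mem

theorem Ansatz.poly_hasParity {σ : B →ₐ[ℝ] B} {φ : SmoothFun U → B} (hφ0 : φ 0 = 0)
    (hφ : ∀ f, HasParity σ 0 (φ f)) {A : ι → B} (hA : ∀ a, HasParity σ (deg a) (A a))
    (α : Fin n ⊕ ι) : HasParity σ (fieldDeg n deg α + 1) (c.poly φ A α) := by
  -- Elements of a fixed parity form a subspace, so only monomials of the right degree have to be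
  -- examined.
  let N : Submodule ℝ B :=
    { carrier := {x | HasParity σ (fieldDeg n deg α + 1) x}
      add_mem' := fun hx hy => hx.add hy
      zero_mem' := .zero _
      smul_mem' := fun r _ hx => hx.smul r }
  refine c.poly_mem (N := N) hφ0 A α fun f l hl => ?_
  have := (hφ f).mul (HasParity.list_prod hA l)
  rwa [hl, zero_add] at this

end Poly

/-! ### Abstract Bianchi identities and $Q^2=0$ -/

section Abstract

variable {n : ℕ} {ι : Type*} [Fintype ι] {U : Opens (Euc n)} {deg : ι → ℕ} (c : Ansatz U deg)

/-- The components of the vector field `Q`. -/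
def Ansatz.component (α : Fin n ⊕ ι) : GradedFun U deg :=
  c.poly (baseFun U deg) (coord U deg) α

theorem Ansatz.component_hasParity (α : Fin n ⊕ ι) :
    HasParity (gradedParity U deg) (fieldDeg n deg α + 1) (c.component α) :=
  c.poly_hasParity (map_zero (baseHom U deg)) hasParity_baseFun hasParity_coord α

theorem Ansatz.Q_skewLeibniz :
    SkewLeibniz (AlgHom.id ℝ (GradedFun U deg)) (gradedParity U deg) c.Q :=
  vectorField_skewLeibniz _ c.component_hasParity

theorem Ansatz.Q_baseFun (f : SmoothFun U) :
    c.Q (baseFun U deg f) = ∑ i, c.component (.inl i) * baseFun U deg (pd U i f) :=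
  vectorField_baseFun _ f

theorem Ansatz.Q_coord (a : ι) : c.Q (coord U deg a) = c.component (.inr a) :=
  vectorField_coord _ a

theorem Ansatz.Q_xcoord (i : Fin n) :
    c.Q (baseFun U deg (xcoord U i)) = c.component (.inl i) :=
  vectorField_xcoord _ i

/-- $Q$ raises the degree by one and so reverses parity. This sign cancels the cross terms of $Q^2$
on products. -/
theorem Ansatz.Q_parity (x : GradedFun U deg) :
    c.Q (gradedParity U deg x) = -gradedParity U deg (c.Q x) := by
  induction x using gradedFun_induction with
  | base f =>
    rw [gradedParity_baseFun, c.Q_baseFun, map_sum, ← Finset.sum_neg_distrib]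
    refine Finset.sum_congr rfl fun i _ => ?_
    refine (neg_eq_iff_eq_neg.2 ?_).symm
    exact (c.component_hasParity _).map_mul_odd (by simp [fieldDeg]) (gradedParity_baseFun _)
  | coord a =>
    have h := c.component_hasParity (.inr a)
    rw [hasParity_coord, map_smul, c.Q_coord]
    by_cases ha : Even (deg a)
    · rw [h.odd (by simpa [fieldDeg, Nat.even_add_one] using ha), ha.neg_one_pow, one_smul]
      exact (neg_neg _).symm
    · rw [h.even (by simpa [fieldDeg, Nat.even_add_one] using ha),
        (Nat.not_even_iff_odd.1 ha).neg_one_pow]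
      exact neg_one_smul ℝ (c.component (.inr a))
  | add x y hx hy =>
    rw [map_add, map_add, hx, hy, map_add, map_add]
    exact (neg_add _ _).symm
  | mul x y hx hy => exact c.Q_skewLeibniz.anticomm_parity_mul hx hy

/-- `Q² = 0` holds as soon as it holds on the coordinates. -/
theorem Ansatz.Q_sq_eq_zero (h : ∀ α, c.Q (c.component α) = 0) : c.Q ∘ₗ c.Q = 0 := by
  refine LinearMap.ext fun x => ?_
  rw [LinearMap.comp_apply, LinearMap.zero_apply]
  induction x using gradedFun_induction with
  | base f =>
    -- As $Q$ annihilates its own components, $Q^2f=-\sum Q^iQ^j\,\partial_j\partial_if$, where odd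
    -- anticommuting factors meet a symmetric Hessian.
    have h1 : c.Q (c.Q (baseFun U deg f)) = ∑ i, -∑ j, c.component (.inl i) *
        (c.component (.inl j) * baseFun U deg (pd U j (pd U i f))) := by
      rw [c.Q_baseFun, map_sum]
      refine Finset.sum_congr rfl fun i _ => ?_
      rw [← Finset.mul_sum, ← c.Q_baseFun]
      exact c.Q_skewLeibniz.mul_of_map_eq_zero (c.component_hasParity _) (by simp [fieldDeg])
        (h _) _
    rw [h1, Finset.sum_neg_distrib]
    refine neg_eq_zero.2 (isParity_graded.sum_mul_symm_eq_zero (k := 1)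
      (V := fun i => c.component (.inl i)) (fun i => c.component_hasParity (.inl i)) (by simp)
      (g := fun j i => baseFun U deg (pd U j (pd U i f))) fun i j => ?_)
    rw [pd_comm]
  | coord a => rw [c.Q_coord, h]
  | add x y hx hy => rw [map_add, map_add, hx, hy, add_zero]
  | mul x y hx hy => exact c.Q_skewLeibniz.sq_mul c.Q_parity hx hy

/-- Functions on the target as functions of the abstract gauge fields. -/
def targetIncl (U : Opens (Euc n)) (deg : ι → ℕ) : GradedFun U deg →ₐ[ℝ] FieldAlg U deg :=
  gradedLift (σ := gradedParity U (jetDeg n deg)) isParity_graded (baseHom U (jetDeg n deg))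
    (fun f => hasParity_baseFun f) (fun a => coord U (jetDeg n deg) (.inl a))
    fun a => hasParity_coord (U := U) (deg := jetDeg n deg) (.inl a)

/-- Evaluation of the abstract gauge fields with vanishing field strengths. -/
def Ansatz.reduce : FieldAlg U deg →ₐ[ℝ] GradedFun U deg :=
  gradedLift isParity_graded (baseHom U deg) hasParity_baseFun
    -- The sign comes from solving $F^\alpha=0$ for $dA^\alpha$.
    (Sum.elim (coord U deg) fun α => -c.component α) fun
      | .inl a => hasParity_coord a
      | .inr α => (c.component_hasParity α).neg

omit [Fintype ι] in
theorem targetIncl_baseFun (f : SmoothFun U) :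
    targetIncl U deg (baseFun U deg f) = baseFun U _ f :=
  gradedLift_baseFun ..

omit [Fintype ι] in
theorem targetIncl_coord (a : ι) : targetIncl U deg (coord U deg a) = coord U _ (.inl a) :=
  gradedLift_coord ..

theorem Ansatz.reduce_baseFun (f : SmoothFun U) : c.reduce (baseFun U _ f) = baseFun U deg f :=
  gradedLift_baseFun ..

theorem Ansatz.reduce_coord_inl (a : ι) : c.reduce (coord U _ (.inl a)) = coord U deg a :=
  gradedLift_coord ..

theorem Ansatz.reduce_coord_inr (α : Fin n ⊕ ι) :
    c.reduce (coord U _ (.inr α)) = -c.component α :=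
  gradedLift_coord ..

theorem targetIncl_component (α : Fin n ⊕ ι) :
    targetIncl U deg (c.component α) =
      c.poly (baseFun U (jetDeg n deg)) (fun a => coord U (jetDeg n deg) (.inl a)) α := by
  rw [Ansatz.component, Ansatz.map_poly]
  simp only [targetIncl_baseFun, targetIncl_coord]

theorem Ansatz.fieldStrength_eq (α : Fin n ⊕ ι) :
    c.fieldStrength α = coord U (jetDeg n deg) (.inr α) + targetIncl U deg (c.component α) := by
  rw [targetIncl_component, Ansatz.fieldStrength]

theorem Ansatz.reduce_comp_targetIncl : c.reduce.comp (targetIncl U deg) = AlgHom.id ℝ _ :=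
  gradedFun_hom_ext
    (fun f => by rw [AlgHom.comp_apply, targetIncl_baseFun, c.reduce_baseFun, AlgHom.id_apply])
    fun a => by rw [AlgHom.comp_apply, targetIncl_coord, c.reduce_coord_inl, AlgHom.id_apply]

theorem Ansatz.reduce_targetIncl (x : GradedFun U deg) : c.reduce (targetIncl U deg x) = x :=
  DFunLike.congr_fun c.reduce_comp_targetIncl x

theorem Ansatz.reduce_fieldStrength (α : Fin n ⊕ ι) : c.reduce (c.fieldStrength α) = 0 := by
  rw [c.fieldStrength_eq, map_add, c.reduce_coord_inr, c.reduce_targetIncl, neg_add_cancel]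

/-- The ideal generated by the field strengths is the kernel of `Ansatz.reduce`. -/
theorem Ansatz.mem_span_fieldStrength (x : FieldAlg U deg) :
    x ∈ TwoSidedIdeal.span (Set.range c.fieldStrength) ↔ c.reduce x = 0 := by
  set I := TwoSidedIdeal.span (Set.range c.fieldStrength) with hI
  constructor
  · intro hx
    have : I ≤ TwoSidedIdeal.ker c.reduce := by
      rw [hI, TwoSidedIdeal.span_le]
      rintro _ ⟨α, rfl⟩
      exact (TwoSidedIdeal.mem_ker _).2 (c.reduce_fieldStrength α)
    exact (TwoSidedIdeal.mem_ker _).1 (this hx)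
  -- Modulo the ideal every element is congruent to its reduction, rewritten in the $A^\alpha$
  -- alone. Among generators only $dA^\alpha$ changes, and it changes by exactly $F^\alpha$.
  · have key : x - targetIncl U deg (c.reduce x) ∈ I := by
      induction x using gradedFun_induction with
      | base f =>
        rw [c.reduce_baseFun, targetIncl_baseFun, sub_self]
        exact I.zero_mem
      | coord a =>
        rcases a with a | α
        · rw [c.reduce_coord_inl, targetIncl_coord, sub_self]
          exact I.zero_mem
        · rw [c.reduce_coord_inr, map_neg, sub_neg_eq_add, ← c.fieldStrength_eq]
          exact TwoSidedIdeal.subset_span ⟨α, rfl⟩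
      | add x y hx hy =>
        rw [map_add, map_add, add_sub_add_comm]
        exact I.add_mem hx hy
      | mul x y hx hy =>
        have e : x * y - targetIncl U deg (c.reduce (x * y)) =
            (x - targetIncl U deg (c.reduce x)) * y +
              targetIncl U deg (c.reduce x) * (y - targetIncl U deg (c.reduce y)) := by
          rw [map_mul, map_mul]
          exact mul_sub_mul_eq _ _ _ _
        rw [e]
        exact I.add_mem (I.mul_mem_right _ _ hx) (I.mul_mem_left _ _ hy)
    intro hx
    rwa [hx, map_zero, sub_zero] at key

theorem fieldD_skewLeibniz :
    SkewLeibniz (AlgHom.id ℝ (FieldAlg U deg)) (gradedParity U (jetDeg n deg))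
      (fieldD U deg) :=
  vectorField_skewLeibniz _ fun
    | .inl i => hasParity_coord (deg := jetDeg n deg) (.inr (.inl i))
    | .inr (.inl a) => hasParity_coord (deg := jetDeg n deg) (.inr (.inr a))
    | .inr (.inr _) => .zero _

theorem fieldD_baseFun (f : SmoothFun U) :
    fieldD U deg (baseFun U _ f) =
      ∑ i, coord U (jetDeg n deg) (.inr (.inl i)) * baseFun U _ (pd U i f) :=
  vectorField_baseFun _ f

theorem fieldD_coord_inl (a : ι) :
    fieldD U deg (coord U _ (.inl a)) = coord U (jetDeg n deg) (.inr (.inr a)) :=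
  vectorField_coord _ _

theorem fieldD_coord_inr (α : Fin n ⊕ ι) :
    fieldD U deg (coord U _ (.inr α)) = 0 :=
  vectorField_coord _ _

theorem Ansatz.reduce_parity (x : FieldAlg U deg) :
    c.reduce (gradedParity U _ x) = gradedParity U deg (c.reduce x) :=
  gradedLift_parity ..

omit [Fintype ι] in
theorem targetIncl_parity (x : GradedFun U deg) :
    targetIncl U deg (gradedParity U deg x) = gradedParity U _ (targetIncl U deg x) :=
  gradedLift_parity ..

/-- Both sides are odd derivations of the target functions, since reduction undoes the inclusion and
respects parity. On $q^a$ the left side produces $dA^a$, which reduces to $-Q^a$. -/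
theorem Ansatz.reduce_fieldD_targetIncl (x : GradedFun U deg) :
    c.reduce (fieldD U deg (targetIncl U deg x)) = -c.Q x := by
  have h1 := (fieldD_skewLeibniz.comp_hom (targetIncl U deg)).hom_comp c.reduce
  have e1 : c.reduce.comp ((AlgHom.id ℝ _).comp (targetIncl U deg)) = AlgHom.id ℝ _ :=
    c.reduce_comp_targetIncl
  have e2 : c.reduce.comp ((gradedParity U _).comp (targetIncl U deg)) = gradedParity U deg :=
    AlgHom.ext fun x => by
      simp only [AlgHom.comp_apply]
      rw [← targetIncl_parity, c.reduce_targetIncl]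
  rw [e1, e2] at h1
  refine DFunLike.congr_fun (h1.ext_graded c.Q_skewLeibniz.neg (fun f => ?_) fun a => ?_) x
  · change c.reduce (fieldD U deg (targetIncl U deg (baseFun U deg f))) = -c.Q (baseFun U deg f)
    rw [targetIncl_baseFun, fieldD_baseFun, map_sum, c.Q_baseFun, ← Finset.sum_neg_distrib]
    refine Finset.sum_congr rfl fun i _ => ?_
    rw [map_mul, c.reduce_coord_inr, c.reduce_baseFun]
    exact neg_mul (c.component (.inl i)) _
  · change c.reduce (fieldD U deg (targetIncl U deg (coord U deg a))) = -c.Q (coord U deg a)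
    rw [targetIncl_coord, fieldD_coord_inl, c.reduce_coord_inr, c.Q_coord]

/-- Only the polynomial part contributes, because $d(dA^\alpha)=0$. The right side is the exact
obstruction to $dF^\alpha\in\mathcal I$. -/
theorem Ansatz.reduce_fieldD_fieldStrength (α : Fin n ⊕ ι) :
    c.reduce (fieldD U deg (c.fieldStrength α)) = -c.Q (c.component α) := by
  rw [c.fieldStrength_eq, map_add, fieldD_coord_inr, zero_add, c.reduce_fieldD_targetIncl]

theorem Ansatz.Q_component_eq_zero (h : c.Q ∘ₗ c.Q = 0) (α : Fin n ⊕ ι) :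
    c.Q (c.component α) = 0 := by
  rcases α with i | a
  · rw [← c.Q_xcoord]; exact DFunLike.congr_fun h _
  · rw [← c.Q_coord]; exact DFunLike.congr_fun h _

/-- The intertwining relation is automatic on $X^i$ and $A^a$. The hypothesis $Q^2=0$ enters only on
the generators $dA^\alpha$, where $d(dA^\alpha)=0$ has to match $Q(Q^\alpha)$. -/
theorem Ansatz.reduce_fieldD (h : c.Q ∘ₗ c.Q = 0) (x : FieldAlg U deg) :
    c.reduce (fieldD U deg x) = -c.Q (c.reduce x) := by
  have h1 := fieldD_skewLeibniz.hom_comp c.reduce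
  have h2 := (c.Q_skewLeibniz.neg).comp_hom c.reduce
  have e : c.reduce.comp (gradedParity U _) = (gradedParity U deg).comp c.reduce :=
    AlgHom.ext c.reduce_parity
  rw [e] at h1
  refine DFunLike.congr_fun (h1.ext_graded h2 (fun f => ?_) fun a => ?_) x
  · change c.reduce (fieldD U deg (baseFun U _ f)) = -c.Q (c.reduce (baseFun U _ f))
    rw [c.reduce_baseFun, ← c.reduce_fieldD_targetIncl, targetIncl_baseFun]
  · change c.reduce (fieldD U deg (coord U _ a)) = -c.Q (c.reduce (coord U _ a))
    rcases a with a | α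
    · rw [c.reduce_coord_inl, ← c.reduce_fieldD_targetIncl, targetIncl_coord]
    · rw [fieldD_coord_inr, c.reduce_coord_inr, map_neg, c.Q_component_eq_zero h, map_zero,
        neg_zero, neg_zero]

theorem Ansatz.abstractBianchi_of_Q_sq (h : c.Q ∘ₗ c.Q = 0) : c.AbstractBianchi := by
  intro x hx
  rw [c.mem_span_fieldStrength] at hx ⊢
  rw [c.reduce_fieldD h, hx, map_zero, neg_zero]

theorem Ansatz.Q_sq_of_abstractBianchi (h : c.AbstractBianchi) : c.Q ∘ₗ c.Q = 0 := by
  refine c.Q_sq_eq_zero fun α => ?_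
  have := h _ (TwoSidedIdeal.subset_span ⟨α, rfl⟩)
  rwa [c.mem_span_fieldStrength, c.reduce_fieldD_fieldStrength, neg_eq_zero] at this

end Abstract

/-! ### Homogeneous functions and the Euler vector field -/

section Homogeneous

variable {n : ℕ} {κ : Type*} {U : Opens (Euc n)} {deg : κ → ℕ}

/-- The functions of degree `D` on the graded manifold. -/
def homog (U : Opens (Euc n)) (deg : κ → ℕ) (D : ℕ) : Submodule ℝ (GradedFun U deg) :=
  Submodule.span ℝ {w | ∃ (f : SmoothFun U) (l : List κ), (l.map deg).sum = D ∧
    w = baseFun U deg f * (l.map (coord U deg)).prod}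

theorem monomial_mem_homog (f : SmoothFun U) {l : List κ} {D : ℕ} (h : (l.map deg).sum = D) :
    baseFun U deg f * (l.map (coord U deg)).prod ∈ homog U deg D :=
  Submodule.subset_span ⟨f, l, h, rfl⟩

theorem baseFun_mem_homog (f : SmoothFun U) : baseFun U deg f ∈ homog U deg 0 := by
  simpa using monomial_mem_homog (deg := deg) f (l := []) (by simp)

theorem coord_mem_homog (a : κ) : coord U deg a ∈ homog U deg (deg a) := by
  have := monomial_mem_homog (U := U) (deg := deg) 1 (l := [a]) (D := deg a) (by simp)
  rw [show baseFun U deg 1 = 1 from map_one (baseHom U deg), one_mul] at this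
  simpa using this

theorem mul_mem_homog {x y : GradedFun U deg} {D E : ℕ} (hx : x ∈ homog U deg D)
    (hy : y ∈ homog U deg E) : x * y ∈ homog U deg (D + E) := by
  induction hx using Submodule.span_induction with
  | zero => rw [zero_mul]; exact zero_mem _
  | add x z _ _ hx hz => rw [add_mul]; exact add_mem hx hz
  | smul r x _ hx => rw [smul_mul_assoc]; exact Submodule.smul_mem _ r hx
  | mem x hx =>
    obtain ⟨f, l, hl, rfl⟩ := hx
    induction hy using Submodule.span_induction with
    | zero => rw [mul_zero]; exact zero_mem _
    | add x z _ _ hx hz => rw [mul_add]; exact add_mem hx hz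
    | smul r x _ hx => rw [mul_smul_comm]; exact Submodule.smul_mem _ r hx
    | mem y hy =>
      obtain ⟨g, l', hl', rfl⟩ := hy
      -- The even coefficient `g` moves past the first word without a sign, so the words
      -- concatenate.
      have e : baseFun U deg f * (l.map (coord U deg)).prod *
          (baseFun U deg g * (l'.map (coord U deg)).prod) =
          baseFun U deg (f * g) * ((l ++ l').map (coord U deg)).prod := by
        rw [show baseFun U deg (f * g) = baseFun U deg f * baseFun U deg g from
          map_mul (baseHom U deg) f g, List.map_append, List.prod_append, mul_assoc, mul_assoc,
          ← mul_assoc _ (baseFun U deg g),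
          ← isParity_graded.commute_of_even (hasParity_baseFun g) (by simp), mul_assoc]
      rw [e]
      exact monomial_mem_homog _ (by simp [hl, hl'])

theorem gradedParity_mem_homog {x : GradedFun U deg} {D : ℕ} (hx : x ∈ homog U deg D) :
    gradedParity U deg x ∈ homog U deg D := by
  induction hx using Submodule.span_induction with
  | zero => rw [map_zero]; exact zero_mem _
  | add x z _ _ hx hz => rw [map_add]; exact add_mem hx hz
  | smul r x _ hx => rw [map_smul]; exact Submodule.smul_mem _ r hx
  | mem x hx =>
    obtain ⟨f, l, hl, rfl⟩ := hx
    rw [(hasParity_baseFun f).mul (HasParity.list_prod hasParity_coord l)]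
    exact Submodule.smul_mem _ _ (monomial_mem_homog f hl)

/-- In degree 0 there are only functions on the base. -/
theorem exists_eq_baseFun_of_mem_homog_zero (hpos : ∀ a, 1 ≤ deg a) {w : GradedFun U deg}
    (hw : w ∈ homog U deg 0) : ∃ f, w = baseFun U deg f := by
  have : homog U deg 0 ≤ LinearMap.range (baseHom U deg).toLinearMap := by
    refine Submodule.span_le.2 ?_
    rintro _ ⟨f, l, hl, rfl⟩
    rcases l with _ | ⟨a, l⟩
    · exact ⟨f, by simp [baseHom_apply]⟩
    · have := hpos a
      simp at hl
      omega
  obtain ⟨f, hf⟩ := this hw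
  exact ⟨f, hf.symm⟩

theorem partialD_inr_base_mul (a : κ) (f : SmoothFun U) (x : GradedFun U deg) :
    partialD U deg (.inr a) (baseFun U deg f * x) =
      baseFun U deg f * partialD U deg (.inr a) x := by
  by_cases ha : Even (deg a)
  · rw [partialD_inr_skewLeibniz_of_even ha, partialD_inr_baseFun]
    simp
  · rw [partialD_inr_skewLeibniz_of_odd ha, partialD_inr_baseFun, gradedParity_baseFun]
    simp

/-- Treats even and odd `a` together. The value of the sign `r` is irrelevant, since it is used only
for membership in a span. -/
theorem partialD_inr_coord_mul (a b : κ) (x : GradedFun U deg) :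
    ∃ r : ℝ, partialD U deg (.inr a) (coord U deg b * x) =
      partialD U deg (.inr a) (coord U deg b) * x +
        r • (coord U deg b * partialD U deg (.inr a) x) := by
  by_cases ha : Even (deg a)
  · exact ⟨1, by rw [partialD_inr_skewLeibniz_of_even ha]; simp⟩
  · refine ⟨(-1) ^ deg b, ?_⟩
    rw [partialD_inr_skewLeibniz_of_odd ha, hasParity_coord, smul_mul_assoc]
    rfl

/-- Each surviving term deletes one occurrence of the letter `a` from the word. The degree condition
is additive to avoid truncated subtraction. -/
theorem partialD_inr_list_prod (a : κ) (l : List κ) :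
    partialD U deg (.inr a) (l.map (coord U deg)).prod ∈
      Submodule.span ℝ {w | ∃ l' : List κ, (l'.map deg).sum + deg a = (l.map deg).sum ∧
        w = (l'.map (coord U deg)).prod} := by
  classical
  induction l with
  | nil =>
    have : partialD U deg (.inr a) 1 = 0 := by
      rw [← map_one (baseHom U deg), baseHom_apply, partialD_inr_baseFun]
    simp only [List.map_nil, List.prod_nil, this]
    exact zero_mem _
  | cons b l ih =>
    simp only [List.map_cons, List.prod_cons]
    obtain ⟨r, hr⟩ := partialD_inr_coord_mul a b (l.map (coord U deg)).prod
    rw [hr, partialD_inr_coord]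
    refine add_mem ?_ (Submodule.smul_mem _ r ?_)
    · split_ifs with h
      · subst h
        rw [one_mul]
        exact Submodule.subset_span ⟨l, by simp [add_comm], rfl⟩
      · rw [zero_mul]
        exact zero_mem _
    · have := Submodule.mem_map_of_mem (f := LinearMap.mulLeft ℝ (coord U deg b)) ih
      rw [Submodule.map_span] at this
      refine Submodule.span_mono ?_ this
      rintro _ ⟨_, ⟨l', hl', rfl⟩, rfl⟩
      exact ⟨b :: l', by simp [← hl', add_assoc], by simp⟩

theorem partialD_inr_mem_homog {a : κ} {w : GradedFun U deg} {D : ℕ} (hw : w ∈ homog U deg D)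
    (h0 : partialD U deg (.inr a) w ≠ 0) :
    deg a ≤ D ∧ partialD U deg (.inr a) w ∈ homog U deg (D - deg a) := by
  have key : partialD U deg (.inr a) w ∈ Submodule.span ℝ {w | ∃ (f : SmoothFun U) (l : List κ),
      (l.map deg).sum + deg a = D ∧ w = baseFun U deg f * (l.map (coord U deg)).prod} := by
    clear h0
    induction hw using Submodule.span_induction with
    | zero => rw [map_zero]; exact zero_mem _
    | add x z _ _ hx hz => rw [map_add]; exact add_mem hx hz
    | smul r x _ hx => rw [map_smul]; exact Submodule.smul_mem _ r hx
    | mem x hx =>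
      obtain ⟨f, l, hl, rfl⟩ := hx
      rw [partialD_inr_base_mul]
      have := Submodule.mem_map_of_mem (f := LinearMap.mulLeft ℝ (baseFun U deg f))
        (partialD_inr_list_prod a l)
      rw [Submodule.map_span] at this
      refine Submodule.span_mono ?_ this
      rintro _ ⟨_, ⟨l', hl', rfl⟩, rfl⟩
      exact ⟨f, l', hl'.trans hl, rfl⟩
  by_cases h : deg a ≤ D
  · refine ⟨h, Submodule.span_mono ?_ key⟩
    rintro _ ⟨f, l, hl, rfl⟩
    exact ⟨f, l, by omega, rfl⟩
  -- If `deg a` exceeds `D`, no word meets the additive condition, so the spanning set is empty and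
  -- the derivative vanishes.
  · refine absurd ?_ h0
    rw [← Submodule.mem_bot (R := ℝ), ← Submodule.span_empty]
    refine Submodule.span_mono ?_ key
    rintro _ ⟨f, l, hl, rfl⟩
    omega

variable [Fintype κ]

/-- The Euler vector field, which acts as multiplication by the degree. -/
def euler (U : Opens (Euc n)) (deg : κ → ℕ) : GradedFun U deg →ₗ[ℝ] GradedFun U deg :=
  ∑ a, (deg a : ℝ) • (LinearMap.mulLeft ℝ (coord U deg a) ∘ₗ partialD U deg (.inr a))

/-- $q^a$ and $\partial/\partial q^a$ have equal parity, so the two signs cancel and each summand is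
an ordinary derivation. -/
theorem euler_skewLeibniz :
    SkewLeibniz (AlgHom.id ℝ (GradedFun U deg)) (AlgHom.id ℝ _) (euler U deg) := by
  refine SkewLeibniz.sum _ fun a _ x y => ?_
  simp only [LinearMap.smul_apply, LinearMap.comp_apply, LinearMap.mulLeft_apply,
    AlgHom.id_apply]
  rw [smul_mul_assoc, mul_smul_comm, ← smul_add]
  congr 1
  by_cases ha : Even (deg a)
  · rw [partialD_inr_skewLeibniz_of_even ha, mul_add, AlgHom.id_apply, AlgHom.id_apply,
      ← mul_assoc, ← mul_assoc, ← mul_assoc,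
      isParity_graded.commute_of_even (hasParity_coord a) ha x]
  · rw [partialD_inr_skewLeibniz_of_odd ha, mul_add, AlgHom.id_apply, ← mul_assoc, ← mul_assoc,
      ← mul_assoc, isParity_graded.mul_comm_of_odd (hasParity_coord a) ha (gradedParity U deg x),
      isParity_graded.invol]

theorem euler_baseFun (f : SmoothFun U) : euler U deg (baseFun U deg f) = 0 := by
  simp [euler, partialD_inr_baseFun]

theorem euler_coord (a : κ) : euler U deg (coord U deg a) = (deg a : ℝ) • coord U deg a := by
  classical
  rw [euler, LinearMap.sum_apply, Finset.sum_eq_single a]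
  · simp [partialD_inr_coord]
  · intro b _ hb
    simp [partialD_inr_coord, hb]
  · simp

theorem euler_of_mem_homog {w : GradedFun U deg} {D : ℕ} (hw : w ∈ homog U deg D) :
    euler U deg w = (D : ℝ) • w := by
  induction hw using Submodule.span_induction with
  | zero => simp
  | add x z _ _ hx hz => rw [map_add, hx, hz, smul_add]
  | smul r x _ hx => rw [map_smul, hx, smul_comm]
  | mem x hx =>
    obtain ⟨f, l, hl, rfl⟩ := hx
    have h : euler U deg (l.map (coord U deg)).prod =
        ((l.map deg).sum : ℝ) • (l.map (coord U deg)).prod := by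
      clear hl
      induction l with
      | nil =>
        simp only [List.map_nil, List.prod_nil, List.sum_nil, euler_skewLeibniz.map_one,
          Nat.cast_zero, zero_smul]
      | cons a l ih =>
        rw [List.map_cons, List.prod_cons, euler_skewLeibniz, ih, euler_coord]
        simp only [AlgHom.id_apply, smul_mul_assoc, mul_smul_comm, ← add_smul, List.map_cons,
          List.sum_cons, Nat.cast_add]
    rw [euler_skewLeibniz, euler_baseFun, h, hl, zero_mul, zero_add, AlgHom.id_apply,
      mul_smul_comm]

/-- Euler's identity $Dw=\sum_a|a|\,q^a\,\partial w/\partial q^a$: if all derivatives vanish, so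
does $w$, as $D\ne0$. -/
theorem exists_partialD_ne_zero {w : GradedFun U deg} {D : ℕ} (hw : w ∈ homog U deg D)
    (hD : D ≠ 0) (h0 : w ≠ 0) : ∃ a, partialD U deg (.inr a) w ≠ 0 := by
  by_contra! h
  have := euler_of_mem_homog hw
  simp only [euler, LinearMap.sum_apply, LinearMap.smul_apply, LinearMap.comp_apply, h, map_zero,
    smul_zero, Finset.sum_const_zero] at this
  exact (smul_ne_zero (Nat.cast_ne_zero.2 hD) h0) this.symm

end Homogeneous

/-! ### Degrees of $Q$ and its components -/

section HomogeneousQ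

variable {n : ℕ} {ι : Type*} [Fintype ι] {U : Opens (Euc n)} {deg : ι → ℕ} (c : Ansatz U deg)

theorem Ansatz.component_mem_homog (α : Fin n ⊕ ι) :
    c.component α ∈ homog U deg (fieldDeg n deg α + 1) :=
  c.poly_mem (map_zero (baseHom U deg)) _ α fun f _ hl => monomial_mem_homog f hl

/-- Applied to the components, this puts $Q(Q^\alpha)$ in degree $|\alpha|+2$, which is the origin
of the dimension bound. -/
theorem Ansatz.Q_mem_homog {w : GradedFun U deg} {D : ℕ} (hw : w ∈ homog U deg D) :
    c.Q w ∈ homog U deg (D + 1) := by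
  induction hw using Submodule.span_induction with
  | zero => rw [map_zero]; exact zero_mem _
  | add x z _ _ hx hz => rw [map_add]; exact add_mem hx hz
  | smul r x _ hx => rw [map_smul]; exact Submodule.smul_mem _ r hx
  | mem x hx =>
    obtain ⟨f, l, rfl, rfl⟩ := hx
    have hl : ∀ l : List ι, (l.map (coord U deg)).prod ∈ homog U deg (l.map deg).sum := fun l => by
      have := monomial_mem_homog (U := U) (deg := deg) 1 (l := l) rfl
      rwa [show baseFun U deg 1 = 1 from map_one (baseHom U deg), one_mul] at this
    have h : c.Q (l.map (coord U deg)).prod ∈ homog U deg ((l.map deg).sum + 1) := by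
      induction l with
      | nil =>
        simp only [List.map_nil, List.prod_nil, c.Q_skewLeibniz.map_one]
        exact zero_mem _
      | cons a l ih =>
        simp only [List.map_cons, List.prod_cons, List.sum_cons]
        rw [c.Q_skewLeibniz, c.Q_coord]
        refine add_mem ?_ ?_
        · have := mul_mem_homog (c.component_mem_homog (.inr a)) (hl l)
          rwa [show fieldDeg n deg (.inr a) = deg a from rfl, add_right_comm] at this
        · rw [add_assoc]
          exact mul_mem_homog (gradedParity_mem_homog (coord_mem_homog a)) ih
    rw [c.Q_skewLeibniz, gradedParity_baseFun, c.Q_baseFun]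
    refine add_mem ?_ ?_
    · rw [AlgHom.id_apply, Finset.sum_mul]
      refine sum_mem fun i _ => ?_
      have := mul_mem_homog (mul_mem_homog (c.component_mem_homog (.inl i))
        (baseFun_mem_homog (pd U i f))) (hl l)
      rwa [show fieldDeg n deg (.inl i) = 0 from rfl, zero_add, add_zero, add_comm] at this
    · have := mul_mem_homog (baseFun_mem_homog f) h
      rwa [zero_add] at this

end HomogeneousQ

/-! ### Detecting functions on the graded manifold by exterior forms -/

section Detection

variable {M : Type*} [AddCommGroup M] [Module ℝ M]

/-- The exterior forms that do not involve the directions with index at least `r`. -/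
def contractKer (c : ℕ → Module.Dual ℝ M) (r : ℕ) : Subalgebra ℝ (ExteriorAlgebra ℝ M) where
  carrier := {u | ∀ j, r ≤ j → CliffordAlgebra.contractLeft (Q := 0) (c j) u = 0}
  mul_mem' := fun {x y} hx hy j hj => by
    rw [contractLeft_skewLeibniz, hx j hj, hy j hj, zero_mul, mul_zero, add_zero]
  add_mem' := fun {x y} hx hy j hj => by rw [map_add, hx j hj, hy j hj, add_zero]
  algebraMap_mem' := fun r j _ => CliffordAlgebra.contractLeft_algebraMap 0 (c j) r

theorem mem_contractKer {c : ℕ → Module.Dual ℝ M} {r : ℕ} {u : ExteriorAlgebra ℝ M} :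
    u ∈ contractKer c r ↔ ∀ j, r ≤ j → CliffordAlgebra.contractLeft (Q := 0) (c j) u = 0 := Iff.rfl

theorem contractKer_mono (c : ℕ → Module.Dual ℝ M) {r s : ℕ} (h : r ≤ s) :
    contractKer c r ≤ contractKer c s := fun _ hu =>
  mem_contractKer.2 fun j hj => mem_contractKer.1 hu j (h.trans hj)

variable {c : ℕ → Module.Dual ℝ M} {e : ℕ → M}

theorem ι_mem_contractKer (hce : ∀ i j, i ≠ j → c i (e j) = 0) {i r : ℕ} (h : i < r) :
    ExteriorAlgebra.ι ℝ (e i) ∈ contractKer c r := by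
  refine mem_contractKer.2 fun j hj => ?_
  rw [ExteriorAlgebra.ι, CliffordAlgebra.contractLeft_ι, hce j i (by omega), map_zero]

/-- The form `e (r + k - 1) ∧ … ∧ e r`. -/
def block (e : ℕ → M) (r : ℕ) : ℕ → ExteriorAlgebra ℝ M
  | 0 => 1
  | k + 1 => ExteriorAlgebra.ι ℝ (e (r + k)) * block e r k

theorem block_mem_exteriorPower (r k : ℕ) : block e r k ∈ ⋀[ℝ]^k M := by
  induction k with
  | zero => exact Submodule.one_le.1 (pow_zero _).ge
  | succ k ih =>
    change _ ∈ (LinearMap.range (ExteriorAlgebra.ι ℝ)) ^ (k + 1)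
    rw [pow_succ']
    exact Submodule.mul_mem_mul (LinearMap.mem_range_self _ _) ih

theorem block_mem_contractKer (hce : ∀ i j, i ≠ j → c i (e j) = 0) (r k : ℕ) :
    block e r k ∈ contractKer c (r + k) := by
  induction k with
  | zero => exact one_mem _
  | succ k ih =>
    exact mul_mem (ι_mem_contractKer hce (by omega)) (contractKer_mono c (by omega) ih)

/-- The leading covector occurs twice. The empty block is 1 and has to be excluded. -/
theorem block_mul_self (r : ℕ) {k : ℕ} (hk : k ≠ 0) : block e r k * block e r k = 0 := by
  obtain ⟨k, rfl⟩ := Nat.exists_eq_succ_of_ne_zero hk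
  change ExteriorAlgebra.ι ℝ (e (r + k)) * block e r k *
    (ExteriorAlgebra.ι ℝ (e (r + k)) * block e r k) = 0
  have h : block e r k * ExteriorAlgebra.ι ℝ (e (r + k)) =
      ExteriorAlgebra.ι ℝ (e (r + k)) * extParity M (block e r k) := by
    rw [ι_mul_eq_parity, isParity_ext.invol]
  rw [mul_assoc, ← mul_assoc (block e r k), h, ← mul_assoc, ← mul_assoc,
    ExteriorAlgebra.ι_sq_zero, zero_mul, zero_mul]

/-- Contraction with the dual of the leading covector strips it off, since no other factor involves
that direction. -/
theorem contractLeft_block_succ_mul {m : ℕ} (hce : ∀ i j, i ≠ j → c i (e j) = 0)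
    (hce1 : ∀ i, i < m → c i (e i) = 1) {r k : ℕ} (hrk : r + k < m) {u : ExteriorAlgebra ℝ M}
    (hu : u ∈ contractKer c r) :
    CliffordAlgebra.contractLeft (Q := 0) (c (r + k)) (block e r (k + 1) * u) =
      block e r k * u := by
  have h : block e r k * u ∈ contractKer c (r + k) :=
    mul_mem (block_mem_contractKer hce r k) (contractKer_mono c (by omega) hu)
  rw [block, mul_assoc, ExteriorAlgebra.ι, CliffordAlgebra.contractLeft_ι_mul,
    mem_contractKer.1 h _ le_rfl,
    hce1 _ hrk, mul_zero, one_smul, sub_zero]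

/-- Stripping the factors one at a time by contraction recovers `u`. -/
theorem block_mul_ne_zero {m : ℕ} (hce : ∀ i j, i ≠ j → c i (e j) = 0)
    (hce1 : ∀ i, i < m → c i (e i) = 1) {r k : ℕ} (hrk : r + k ≤ m) {u : ExteriorAlgebra ℝ M}
    (hu : u ∈ contractKer c r) (h0 : u ≠ 0) : block e r k * u ≠ 0 := by
  induction k with
  | zero => rwa [block, one_mul]
  | succ k ih =>
    intro h
    refine ih (by omega) ?_
    rw [← contractLeft_block_succ_mul hce hce1 (by omega) hu, h, map_zero]

variable {n : ℕ} {κ : Type*} {U : Opens (Euc n)} {deg : κ → ℕ}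

/-- Evaluation of functions on the graded manifold at a point of the base and exterior forms. -/
def evalForms (x : U) (A : κ → ExteriorAlgebra ℝ M)
    (hA : ∀ a, HasParity (extParity M) (deg a) (A a)) :
    GradedFun U deg →ₐ[ℝ] ExteriorAlgebra ℝ M :=
  gradedLift isParity_ext ((Algebra.ofId ℝ (ExteriorAlgebra ℝ M)).comp (evalAt x))
    (fun _ => .of_even (by simp) (AlgHom.commutes _ _)) A hA

theorem evalForms_baseFun (x : U) (A : κ → ExteriorAlgebra ℝ M)
    (hA : ∀ a, HasParity (extParity M) (deg a) (A a)) (f : SmoothFun U) :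
    evalForms x A hA (baseFun U deg f) = algebraMap ℝ _ (f.1 x) :=
  gradedLift_baseFun ..

theorem evalForms_coord (x : U) (A : κ → ExteriorAlgebra ℝ M)
    (hA : ∀ a, HasParity (extParity M) (deg a) (A a)) (a : κ) :
    evalForms x A hA (coord U deg a) = A a :=
  gradedLift_coord ..

theorem evalForms_mem (x : U) (A : κ → ExteriorAlgebra ℝ M)
    (hA : ∀ a, HasParity (extParity M) (deg a) (A a)) {N : Subalgebra ℝ (ExteriorAlgebra ℝ M)}
    (hN : ∀ a, A a ∈ N) (w : GradedFun U deg) : evalForms x A hA w ∈ N := by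
  induction w using gradedFun_induction with
  | base f => rw [evalForms_baseFun]; exact N.algebraMap_mem _
  | coord a => rw [evalForms_coord]; exact hN a
  | add x y hx hy => rw [map_add]; exact add_mem hx hy
  | mul x y hx hy => rw [map_mul]; exact mul_mem hx hy

theorem evalForms_parity (x : U) (A : κ → ExteriorAlgebra ℝ M)
    (hA : ∀ a, HasParity (extParity M) (deg a) (A a)) (w : GradedFun U deg) :
    evalForms x A hA (gradedParity U deg w) = extParity M (evalForms x A hA w) :=
  gradedLift_parity ..

/-- First-order expansions along `θ` multiply by the Leibniz rule, because terms with two factors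
`θ` vanish. -/
theorem taylor_mul_even {B : Type*} [Ring B] {θ : B} (hθ : ∀ b, θ * b = b * θ) (h0 : θ * θ = 0)
    (a b a' b' : B) : (a + θ * a') * (b + θ * b') = a * b + θ * (a' * b + a * b') := by
  have h1 : θ * a' * (θ * b') = 0 := by
    rw [hθ a', mul_assoc, ← mul_assoc θ, h0, zero_mul, mul_zero]
  have h2 : a * (θ * b') = θ * (a * b') := by rw [← mul_assoc, ← hθ, mul_assoc]
  rw [add_mul, mul_add, mul_add, h1, h2, add_zero, mul_add, mul_assoc]
  abel

/-- In the odd case, moving `θ` to the front past `a` creates the twist `σ a` of the odd Leibniz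
rule. -/
theorem taylor_mul_odd {B : Type*} [Ring B] [Algebra ℝ B] {σ : B →ₐ[ℝ] B} (hσ : IsParity σ)
    {θ : B} (hθ : ∀ b, θ * b = σ b * θ) (h0 : θ * θ = 0) (a b a' b' : B) :
    (a + θ * a') * (b + θ * b') = a * b + θ * (a' * b + σ a * b') := by
  have h1 : θ * a' * (θ * b') = 0 := by
    rw [hθ a', mul_assoc, ← mul_assoc θ, h0, zero_mul, mul_zero]
  have h2 : a * (θ * b') = θ * (σ a * b') := by
    rw [← mul_assoc, ← mul_assoc, hθ, hσ.invol]
  rw [add_mul, mul_add, mul_add, h1, h2, add_zero, mul_add, mul_assoc]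
  abel

/-- Taylor expansion of a function on the graded manifold in a direction of square zero. -/
theorem evalForms_add (x : U) (A A' : κ → ExteriorAlgebra ℝ M)
    (hA : ∀ a, HasParity (extParity M) (deg a) (A a))
    (hA' : ∀ a, HasParity (extParity M) (deg a) (A' a)) (a : κ) {θ : ExteriorAlgebra ℝ M}
    (hθ : HasParity (extParity M) (deg a) θ) (h0 : θ * θ = 0) (ha : A' a = A a + θ)
    (hb : ∀ b, b ≠ a → A' b = A b) (w : GradedFun U deg) :
    evalForms x A' hA' w =
      evalForms x A hA w + θ * evalForms x A hA (partialD U deg (.inr a) w) := by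
  classical
  induction w using gradedFun_induction with
  | base f =>
    rw [evalForms_baseFun, evalForms_baseFun, partialD_inr_baseFun, map_zero, mul_zero, add_zero]
  | coord b =>
    rw [evalForms_coord, evalForms_coord, partialD_inr_coord]
    by_cases hab : b = a
    · subst hab; simp [ha]
    · simp [hb b hab, Ne.symm hab]
  | add y z hy hz => rw [map_add, hy, hz, map_add, map_add, map_add, mul_add]; abel
  | mul y z hy hz =>
    rw [map_mul, hy, hz]
    by_cases h : Even (deg a)
    · rw [taylor_mul_even (isParity_ext.commute_of_even hθ h) h0,
        partialD_inr_skewLeibniz_of_even h]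
      simp
    · rw [taylor_mul_odd isParity_ext (isParity_ext.mul_comm_of_odd hθ h) h0,
        partialD_inr_skewLeibniz_of_odd h, map_add, map_mul, map_mul, map_mul, evalForms_parity]
      simp

/-- A nonzero function of degree `D ≤ m` on the graded manifold is detected by exterior forms
in `m` variables. -/
theorem exists_evalForms_ne_zero [Fintype κ] {m : ℕ} (hce : ∀ i j, i ≠ j → c i (e j) = 0)
    (hce1 : ∀ i, i < m → c i (e i) = 1) (hpos : ∀ a, 1 ≤ deg a) (D : ℕ) (hD : D ≤ m)
    (w : GradedFun U deg) (hw : w ∈ homog U deg D) (h0 : w ≠ 0) :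
    ∃ (x : U) (A : κ → ExteriorAlgebra ℝ M) (hA : ∀ a, A a ∈ ⋀[ℝ]^(deg a) M),
      (∀ a, A a ∈ contractKer c D) ∧
        evalForms x A (fun a => hasParity_of_mem_exteriorPower (hA a)) w ≠ 0 := by
  classical
  induction D using Nat.strong_induction_on generalizing w with
  | _ D ih =>
    by_cases hD0 : D = 0
    · subst hD0
      obtain ⟨f, rfl⟩ := exists_eq_baseFun_of_mem_homog_zero hpos hw
      obtain ⟨x, hx⟩ : ∃ x, f.1 x ≠ 0 := by
        by_contra! h
        have : f = 0 := SmoothFun.ext h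
        exact h0 (this ▸ map_zero (baseHom U deg))
      refine ⟨x, fun _ => 0, fun _ => zero_mem _, fun _ => zero_mem _, ?_⟩
      rw [evalForms_baseFun]
      exact mt (ExteriorAlgebra.algebraMap_eq_zero_iff M _).1 hx
    · obtain ⟨a, ha⟩ := exists_partialD_ne_zero hw hD0 h0
      obtain ⟨hle, hmem⟩ := partialD_inr_mem_homog hw ha
      have hk := hpos a
      -- The forms that detect the derivative involve only directions below `D - deg a`, which
      -- leaves exactly `deg a` fresh ones below `D`.
      obtain ⟨x, A, hA, hN, hev⟩ := ih (D - deg a) (by omega) (by omega) _ hmem ha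
      obtain ⟨k, hk'⟩ := Nat.exists_eq_succ_of_ne_zero (by omega : deg a ≠ 0)
      set r := D - deg a with hr
      have hθ := block_mem_exteriorPower (e := e) r (deg a)
      have hθN := block_mem_contractKer hce r (deg a)
      have hA' : ∀ b, Function.update A a (A a + block e r (deg a)) b ∈ ⋀[ℝ]^(deg b) M := by
        intro b
        by_cases hb : b = a
        · subst hb
          rw [Function.update_self]
          exact add_mem (hA b) hθ
        · rw [Function.update_of_ne hb]
          exact hA b
      -- Shifting $A^a$ by the block $\theta$ of fresh covectors changes the value of $w$ by
      -- $\theta\cdot(\partial w/\partial q^a)(A)$.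
      refine ⟨x, Function.update A a (A a + block e r (deg a)), hA', fun b => ?_, fun h => ?_⟩
      · by_cases hb : b = a
        · subst hb
          rw [Function.update_self]
          exact add_mem (contractKer_mono c (by omega) (hN b))
            (contractKer_mono c (by omega) hθN)
        · rw [Function.update_of_ne hb]
          exact contractKer_mono c (by omega) (hN b)
      · rw [evalForms_add x A _ (fun a => hasParity_of_mem_exteriorPower (hA a)) _ a
          (hasParity_of_mem_exteriorPower hθ) (block_mul_self r (by omega))
          (Function.update_self ..) (fun b hb => Function.update_of_ne hb ..)] at h
        -- Contraction with the last fresh direction `r + k = D - 1` kills the unshifted value,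
        -- which involves only directions below `r`, and shortens the block in the other term. What
        -- remains is nonzero.
        have h1 := congrArg (CliffordAlgebra.contractLeft (Q := 0) (c (r + k))) h
        rw [map_add, map_zero, mem_contractKer.1 (evalForms_mem x A _ hN w) _ (by omega), zero_add, hk',
          contractLeft_block_succ_mul hce hce1 (by omega) (evalForms_mem x A _ hN _)] at h1
        exact block_mul_ne_zero hce hce1 (by omega) (evalForms_mem x A _ hN _) hev h1

end Detection

/-! ### Differential forms on open subsets of Euclidean space -/

section LocalForms

variable {m : ℕ} {V : Opens (Euc m)}

theorem formAt_tmul (y : V) (f : SmoothFun V) (u : ExtCov m) :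
    formAt y (f ⊗ₜ u) = f.1 y • u := by
  simp only [formAt, AlgHom.comp_apply, Algebra.TensorProduct.map_tmul]
  exact TensorProduct.lid_tmul _ _

/-- A form is determined by its values. -/
theorem localForm_ext {w v : LocalForm V} (h : ∀ y : V, formAt y w = formAt y v) : w = v := by
  classical
  -- In a basis of the exterior algebra a form is a finite family of smooth coefficient functions,
  -- and these are determined by their values.
  let b := Module.Basis.ofVectorSpace ℝ (ExtCov m)
  let E := TensorProduct.equivFinsuppOfBasisRight (M := SmoothFun V) b
  have key : ∀ (θ : LocalForm V) (y : V) i, (E θ i).1 y = b.repr (formAt y θ) i := by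
    intro θ y i
    induction θ using TensorProduct.induction_on with
    | zero => simp; rfl
    | tmul f u =>
      have : E (f ⊗ₜ u) i = b.repr u i • f :=
        TensorProduct.equivFinsuppOfBasisRight_apply_tmul_apply b f u i
      rw [formAt_tmul, this, map_smul, Finsupp.smul_apply, smul_eq_mul, mul_comm]
      rfl
    | add x z hx hz =>
      rw [map_add, map_add, map_add, Finsupp.add_apply, Finsupp.add_apply, ← hx, ← hz]
      rfl
  refine E.injective (Finsupp.ext fun i => SmoothFun.ext fun y => ?_)
  rw [key, key, h]

/-- The grading automorphism of the differential forms on an open set. -/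
def localParity (V : Opens (Euc m)) : LocalForm V →ₐ[ℝ] LocalForm V :=
  tensorParity (SmoothFun V) (extParity _)

theorem isParity_local : IsParity (localParity V) := isParity_ext.tensor

theorem formAt_localParity (y : V) (w : LocalForm V) :
    formAt y (localParity V w) = extParity _ (formAt y w) := by
  induction w using TensorProduct.induction_on with
  | zero => simp
  | tmul f u => rw [localParity, tensorParity_tmul, formAt_tmul, formAt_tmul, map_smul]
  | add x z hx hz => simp only [map_add, hx, hz]

theorem hasParity_of_formAt {k : ℕ} {w : LocalForm V}
    (h : ∀ y, formAt y w ∈ ⋀[ℝ]^k (Module.Dual ℝ (Euc m))) : HasParity (localParity V) k w :=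
  localForm_ext fun y => by
    rw [formAt_localParity, hasParity_of_mem_exteriorPower (h y), map_smul]

/-- The coordinate differentials as forms on an open set. -/
def localdσ (V : Opens (Euc m)) (μ : Fin m) : LocalForm V :=
  1 ⊗ₜ[ℝ] ExteriorAlgebra.ι ℝ (dσ μ)

theorem localdσ_hasParity (μ : Fin m) : HasParity (localParity V) 1 (localdσ V μ) :=
  .of_odd (by simp) (by
    rw [localParity, localdσ, tensorParity_tmul, extParity_ι, TensorProduct.tmul_neg])

theorem localD_skewLeibniz :
    SkewLeibniz (AlgHom.id ℝ (LocalForm V)) (localParity V) (localD V) :=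
  SkewLeibniz.sum _ fun μ _ =>
    (pd_skewLeibniz μ).tensor_left.mulLeft_odd isParity_local (localdσ_hasParity μ) (by simp)

theorem localD_tmul (f : SmoothFun V) (u : ExtCov m) :
    localD V (f ⊗ₜ u) = ∑ μ, localdσ V μ * (pd V μ f ⊗ₜ u) := by
  simp [localD, localdσ]

/-- The coordinate differentials are odd and closed while partial derivatives commute, so the
antisymmetry argument used for $Q^2$ on base functions applies again. -/
theorem localD_localD (w : LocalForm V) : localD V (localD V w) = 0 := by
  induction w using TensorProduct.induction_on with
  | zero => simp
  | add x z hx hz => rw [map_add, map_add, hx, hz, add_zero]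
  | tmul f u =>
    have h1 : localD V (localD V (f ⊗ₜ u)) =
        ∑ μ, -∑ ν, localdσ V μ * (localdσ V ν * (pd V ν (pd V μ f) ⊗ₜ u)) := by
      rw [localD_tmul, map_sum]
      refine Finset.sum_congr rfl fun μ _ => ?_
      rw [← Finset.mul_sum, ← localD_tmul]
      refine localD_skewLeibniz.mul_of_map_eq_zero (localdσ_hasParity μ) (by simp) ?_ _
      rw [localdσ, localD_tmul]
      refine Finset.sum_eq_zero fun ν _ => ?_
      rw [(pd_skewLeibniz ν).map_one, TensorProduct.zero_tmul, mul_zero]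
    rw [h1, Finset.sum_neg_distrib]
    refine neg_eq_zero.2 (isParity_local.sum_mul_symm_eq_zero (k := 1) (V := localdσ V)
      localdσ_hasParity (by simp) (g := fun ν μ => pd V ν (pd V μ f) ⊗ₜ u) fun μ ν => ?_)
    rw [pd_comm]

theorem localD_localParity (w : LocalForm V) :
    localD V (localParity V w) = -localParity V (localD V w) := by
  induction w using TensorProduct.induction_on with
  | zero => simp
  | add x z hx hz =>
    rw [map_add, map_add, hx, hz, map_add, map_add]
    exact (neg_add _ _).symm
  | tmul f u =>
    rw [localParity, tensorParity_tmul, localD_tmul, localD_tmul, map_sum,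
      ← Finset.sum_neg_distrib]
    refine Finset.sum_congr rfl fun μ _ => ?_
    rw [map_mul, tensorParity_tmul, ← localParity, (localdσ_hasParity μ).odd (by simp)]
    exact (neg_eq_iff_eq_neg.1 (neg_mul (localdσ V μ) _).symm)

theorem HasParity.localD {k : ℕ} {w : LocalForm V} (h : HasParity (localParity V) k w) :
    HasParity (localParity V) (k + 1) (localD V w) := by
  have h1 := localD_localParity w
  rw [h, map_smul] at h1
  rw [HasParity, pow_succ, mul_neg_one, neg_smul, h1]
  exact (neg_neg _).symm

end LocalForms

/-! ### Inserting gauge fields into the abstract algebra -/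

section Evaluation

variable {m n : ℕ} {S : Type*} [TopologicalSpace S] [ChartedSpace (Euc m) S]
  [IsManifold (𝓡 m) ∞ S] {ι : Type*} {U : Opens (Euc n)} {deg : ι → ℕ}

/-- Composition with the scalar fields as an algebra homomorphism. -/
def GaugeField.funOfXHom (Φ : GaugeField m S U deg) (e : atlas (Euc m) S) :
    SmoothFun U →ₐ[ℝ] SmoothFun (chartTarget e) where
  toFun := Φ.funOfX e
  map_one' := SmoothFun.ext fun _ => rfl
  map_mul' _ _ := SmoothFun.ext fun _ => rfl
  map_zero' := SmoothFun.ext fun _ => rfl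
  map_add' _ _ := SmoothFun.ext fun _ => rfl
  commutes' _ := SmoothFun.ext fun _ => rfl

/-- The chain rule. -/
theorem GaugeField.pd_funOfX (Φ : GaugeField m S U deg) (e : atlas (Euc m) S) (μ : Fin m)
    (f : SmoothFun U) : pd (chartTarget e) μ (Φ.funOfX e f) =
      ∑ i, pd (chartTarget e) μ (Φ.funOfX e (xcoord U i)) * Φ.funOfX e (pd U i f) := by
  refine SmoothFun.ext fun y => ?_
  have he : e.1 ∈ IsManifold.maximalAtlas (𝓡 m) ∞ S := IsManifold.subset_maximalAtlas e.2
  have hX : DifferentiableAt ℝ (fun y => Φ.X (e.1.symm y)) (y : Euc m) := by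
    have h : ContDiffOn ℝ ∞ (fun y => Φ.X (e.1.symm y)) e.1.target :=
      contMDiffOn_iff_contDiffOn.1
        (Φ.smooth.comp_contMDiffOn (contMDiffOn_symm_of_mem_maximalAtlas he))
    exact (h.differentiableOn (by simp)).differentiableAt (e.1.open_target.mem_nhds y.2)
  set x : U := ⟨Φ.X (e.1.symm y), Φ.mem _⟩ with hx
  have h1 : (pd (chartTarget e) μ (Φ.funOfX e f)).1 y =
      fderiv ℝ (extendZero f.1) (x : Euc n)
        (fderiv ℝ (fun y => Φ.X (e.1.symm y)) (y : Euc m) (EuclideanSpace.single μ 1)) := by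
    rw [pd_apply_of_eq (g := fun y => extendZero f.1 (Φ.X (e.1.symm y)))
      fun y => (extendZero_apply f.1 ⟨Φ.X (e.1.symm y), Φ.mem _⟩).symm]
    rw [fderiv_fun_comp (g := extendZero f.1) (y : Euc m) (extendZero_differentiableAt f x) hX]
    rfl
  have h2 : ∀ i, (pd (chartTarget e) μ (Φ.funOfX e (xcoord U i))).1 y =
      (fderiv ℝ (fun y => Φ.X (e.1.symm y)) (y : Euc m) (EuclideanSpace.single μ 1)) i := by
    intro i
    rw [pd_apply_of_eq (g := fun y => EuclideanSpace.proj (𝕜 := ℝ) i (Φ.X (e.1.symm y)))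
      fun y => rfl]
    rw [fderiv_fun_comp (g := EuclideanSpace.proj (𝕜 := ℝ) i) (y : Euc m)
      (ContinuousLinearMap.differentiableAt _) hX, ContinuousLinearMap.fderiv]
    rfl
  have h3 : ∀ g : Fin n → SmoothFun (chartTarget e), (∑ i, g i).1 y = ∑ i, (g i).1 y := fun g =>
    map_sum (evalAt y) g _
  rw [h1, h3]
  set v := fderiv ℝ (fun y => Φ.X (e.1.symm y)) (y : Euc m) (EuclideanSpace.single μ 1)
  have hv : v = ∑ i, v i • EuclideanSpace.single i (1 : ℝ) := by
    ext j
    simp [Finset.sum_apply, Pi.single_apply]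
  conv_lhs => rw [hv, map_sum]
  refine Finset.sum_congr rfl fun i _ => ?_
  change _ = (pd (chartTarget e) μ (Φ.funOfX e (xcoord U i))).1 y * (pd U i f).1 x
  rw [h2, map_smul, smul_eq_mul, pd_apply]

theorem gaugeFunctional_hasParity (Φ : GaugeField m S U deg) (e : atlas (Euc m) S)
    (α : Fin n ⊕ ι) : HasParity (localParity (chartTarget e)) (fieldDeg n deg α)
      (gaugeFunctional m S U deg α Φ e) := by
  rcases α with i | a
  · exact .of_even (by simp [fieldDeg])
      (by simp [gaugeFunctional, scalarFunctional, localParity])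
  · exact hasParity_of_formAt ((Φ.A a).degree e)

/-- Evaluation of functions of the abstract gauge fields on gauge fields on `S`. -/
def GaugeField.eval (Φ : GaugeField m S U deg) (e : atlas (Euc m) S) :
    FieldAlg U deg →ₐ[ℝ] LocalForm (chartTarget e) :=
  gradedLift isParity_local (Algebra.TensorProduct.includeLeft.comp (Φ.funOfXHom e))
    (fun f => .of_even (by simp) (by simp [localParity]))
    (Sum.elim (fun a => (Φ.A a).inChart e)
      fun α => localD _ (gaugeFunctional m S U deg α Φ e)) fun
      | .inl a => gaugeFunctional_hasParity Φ e (.inr a)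
      | .inr α => (gaugeFunctional_hasParity Φ e α).localD

theorem GaugeField.eval_baseFun (Φ : GaugeField m S U deg) (e : atlas (Euc m) S)
    (f : SmoothFun U) : Φ.eval e (baseFun U _ f) = Φ.funOfX e f ⊗ₜ 1 :=
  gradedLift_baseFun ..

theorem GaugeField.eval_coord_inl (Φ : GaugeField m S U deg) (e : atlas (Euc m) S) (a : ι) :
    Φ.eval e (coord U _ (.inl a)) = (Φ.A a).inChart e :=
  gradedLift_coord ..

theorem GaugeField.eval_coord_inr (Φ : GaugeField m S U deg) (e : atlas (Euc m) S)
    (α : Fin n ⊕ ι) : Φ.eval e (coord U _ (.inr α)) =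
      localD _ (gaugeFunctional m S U deg α Φ e) :=
  gradedLift_coord ..

theorem GaugeField.eval_parity (Φ : GaugeField m S U deg) (e : atlas (Euc m) S)
    (x : FieldAlg U deg) : Φ.eval e (gradedParity U _ x) = localParity _ (Φ.eval e x) :=
  gradedLift_parity ..

variable (m S U deg) in
/-- Functions of the abstract gauge fields as functionals. -/
def toFunctional : FieldAlg U deg →ₐ[ℝ] Functional m S U deg :=
  AlgHom.pi fun Φ => AlgHom.pi fun e => Φ.eval e

theorem toFunctional_apply (x : FieldAlg U deg) (Φ : GaugeField m S U deg)
    (e : atlas (Euc m) S) : toFunctional m S U deg x Φ e = Φ.eval e x := rfl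

theorem toFunctional_baseFun (f : SmoothFun U) :
    toFunctional m S U deg (baseFun U _ f) = scalarFunctional m S U deg f :=
  funext fun Φ => funext fun e => Φ.eval_baseFun e f

theorem toFunctional_coord_inl (a : ι) :
    toFunctional m S U deg (coord U _ (.inl a)) = gaugeFunctional m S U deg (.inr a) :=
  funext fun Φ => funext fun e => Φ.eval_coord_inl e a

theorem toFunctional_coord_inr (α : Fin n ⊕ ι) :
    toFunctional m S U deg (coord U _ (.inr α)) =
      functionalD m S U deg (gaugeFunctional m S U deg α) :=
  funext fun Φ => funext fun e => Φ.eval_coord_inr e α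

/-- Generators go to generators, with $X^i$ the image of a coordinate function on $U$. Statements
about the abstract algebra can therefore be pushed forward to functionals. -/
theorem range_toFunctional : (toFunctional m S U deg).range = functionalAlg m S U deg := by
  apply le_antisymm
  · rintro _ ⟨x, rfl⟩
    change toFunctional m S U deg x ∈ functionalAlg m S U deg
    induction x using gradedFun_induction with
    | base f =>
      rw [toFunctional_baseFun]
      exact Algebra.subset_adjoin (.inl (.inl ⟨f, rfl⟩))
    | coord a =>
      rcases a with a | α
      · rw [toFunctional_coord_inl]
        exact Algebra.subset_adjoin (.inl (.inr ⟨_, rfl⟩))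
      · rw [toFunctional_coord_inr]
        exact Algebra.subset_adjoin (.inr ⟨α, rfl⟩)
    | add x y hx hy => rw [map_add]; exact add_mem hx hy
    | mul x y hx hy => rw [map_mul]; exact mul_mem hx hy
  · refine Algebra.adjoin_le ?_
    rintro _ ((⟨f, rfl⟩ | ⟨i | a, rfl⟩) | ⟨α, rfl⟩)
    · exact ⟨_, toFunctional_baseFun f⟩
    · exact ⟨_, toFunctional_baseFun _⟩
    · exact ⟨_, toFunctional_coord_inl a⟩
    · exact ⟨_, toFunctional_coord_inr α⟩

variable (m S U deg) in
/-- `toFunctional` with values in the algebra of functionals generated by the gauge fields and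
their differentials. -/
def toFunctionalAlg : FieldAlg U deg →ₐ[ℝ] functionalAlg m S U deg :=
  (toFunctional m S U deg).codRestrict _ fun x => by
    rw [← range_toFunctional]; exact ⟨x, rfl⟩

theorem toFunctionalAlg_surjective : Function.Surjective (toFunctionalAlg m S U deg) := by
  rintro ⟨G, hG⟩
  rw [← range_toFunctional] at hG
  obtain ⟨x, hx⟩ := hG
  exact ⟨x, Subtype.ext hx⟩

theorem coe_toFunctionalAlg (x : FieldAlg U deg) :
    (toFunctionalAlg m S U deg x : Functional m S U deg) = toFunctional m S U deg x := rfl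

variable [Fintype ι]

/-- Both sides are odd derivations along the evaluation. On base functions the claim is the chain
rule, on $A^a$ it is immediate, and on $dA^\alpha$ it is $d^2=0$. -/
theorem GaugeField.eval_fieldD (Φ : GaugeField m S U deg) (e : atlas (Euc m) S)
    (x : FieldAlg U deg) : Φ.eval e (fieldD U deg x) = localD _ (Φ.eval e x) := by
  have h1 := fieldD_skewLeibniz.hom_comp (Φ.eval e)
  have h2 := localD_skewLeibniz.comp_hom (Φ.eval e)
  have he : (Φ.eval e).comp (gradedParity U _) = (localParity _).comp (Φ.eval e) :=
    AlgHom.ext (Φ.eval_parity e)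
  rw [he] at h1
  refine DFunLike.congr_fun (h1.ext_graded h2 (fun f => ?_) fun a => ?_) x
  · simp only [LinearMap.comp_apply, AlgHom.toLinearMap_apply]
    rw [fieldD_baseFun, map_sum, Φ.eval_baseFun, localD_tmul]
    have h : ∀ μ, localdσ (chartTarget e) μ * (pd _ μ (Φ.funOfX e f) ⊗ₜ 1) =
        ∑ i, localdσ (chartTarget e) μ * ((pd _ μ (Φ.funOfX e (xcoord U i)) *
          Φ.funOfX e (pd U i f)) ⊗ₜ 1) := fun μ => by
      rw [Φ.pd_funOfX, TensorProduct.sum_tmul, Finset.mul_sum]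
    rw [Finset.sum_congr rfl fun μ _ => h μ, Finset.sum_comm]
    refine Finset.sum_congr rfl fun i _ => ?_
    rw [map_mul, Φ.eval_coord_inr, Φ.eval_baseFun, gaugeFunctional, scalarFunctional,
      localD_tmul, Finset.sum_mul]
    refine Finset.sum_congr rfl fun μ _ => ?_
    rw [mul_assoc, Algebra.TensorProduct.tmul_mul_tmul, one_mul]
  · simp only [LinearMap.comp_apply, AlgHom.toLinearMap_apply]
    rcases a with a | α
    · rw [fieldD_coord_inl, Φ.eval_coord_inr, Φ.eval_coord_inl]
      rfl
    · rw [fieldD_coord_inr, map_zero, Φ.eval_coord_inr, localD_localD]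

theorem toFunctional_fieldD (x : FieldAlg U deg) :
    toFunctional m S U deg (fieldD U deg x) =
      functionalD m S U deg (toFunctional m S U deg x) :=
  funext fun Φ => funext fun e => Φ.eval_fieldD e x

theorem toFunctional_fieldStrength (c : Ansatz U deg) (α : Fin n ⊕ ι) :
    toFunctional m S U deg (c.fieldStrength α) = c.fieldStrengthOn m S α := by
  rw [Ansatz.fieldStrength, map_add, Ansatz.map_poly, toFunctional_coord_inr]
  simp only [toFunctional_baseFun, toFunctional_coord_inl]
  rfl

theorem GaugeField.eval_fieldStrength (c : Ansatz U deg) (Φ : GaugeField m S U deg)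
    (e : atlas (Euc m) S) (α : Fin n ⊕ ι) :
    Φ.eval e (c.fieldStrength α) = c.fieldStrengthOn m S α Φ e :=
  congrFun (congrFun (toFunctional_fieldStrength c α) Φ) e

variable (c : Ansatz U deg)

theorem Ansatz.toFunctionalAlg_fieldStrength_mem (α : Fin n ⊕ ι) :
    toFunctionalAlg m S U deg (c.fieldStrength α) ∈ c.idealOn m S :=
  TwoSidedIdeal.subset_span ⟨α, toFunctional_fieldStrength c α⟩

/-- A surjective homomorphism maps the ideal of the generators onto the ideal of their images.
Surjectivity lifts the multipliers. -/
theorem Ansatz.mem_idealOn (G : functionalAlg m S U deg) :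
    G ∈ c.idealOn m S ↔ ∃ x ∈ TwoSidedIdeal.span (Set.range c.fieldStrength),
      toFunctionalAlg m S U deg x = G := by
  constructor
  · intro hG
    refine TwoSidedIdeal.span_induction
      (p := fun G _ => ∃ x ∈ TwoSidedIdeal.span (Set.range c.fieldStrength),
        toFunctionalAlg m S U deg x = G) ?_ ?_ ?_ ?_ ?_ ?_ hG
    · rintro G ⟨α, hα⟩
      exact ⟨_, TwoSidedIdeal.subset_span ⟨α, rfl⟩,
        Subtype.ext ((toFunctional_fieldStrength c α).trans hα.symm)⟩
    · exact ⟨0, TwoSidedIdeal.zero_mem _, map_zero _⟩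
    · rintro _ _ _ _ ⟨x, hx, rfl⟩ ⟨y, hy, rfl⟩
      exact ⟨x + y, TwoSidedIdeal.add_mem _ hx hy, map_add _ _ _⟩
    · rintro _ _ ⟨x, hx, rfl⟩
      exact ⟨-x, TwoSidedIdeal.neg_mem _ hx, map_neg _ _⟩
    · rintro G _ _ ⟨x, hx, rfl⟩
      obtain ⟨g, rfl⟩ := toFunctionalAlg_surjective G
      exact ⟨g * x, TwoSidedIdeal.mul_mem_left _ _ _ hx, map_mul _ _ _⟩
    · rintro G _ _ ⟨x, hx, rfl⟩
      obtain ⟨g, rfl⟩ := toFunctionalAlg_surjective G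
      exact ⟨x * g, TwoSidedIdeal.mul_mem_right _ _ _ hx, map_mul _ _ _⟩
  · rintro ⟨x, hx, rfl⟩
    refine TwoSidedIdeal.span_induction
      (p := fun x _ => toFunctionalAlg m S U deg x ∈ c.idealOn m S) ?_ ?_ ?_ ?_ ?_ ?_ hx
    · rintro _ ⟨α, rfl⟩
      exact c.toFunctionalAlg_fieldStrength_mem α
    · rw [map_zero]; exact TwoSidedIdeal.zero_mem _
    · intro x y _ _ hx hy
      rw [map_add]; exact TwoSidedIdeal.add_mem _ hx hy
    · intro x _ hx
      rw [map_neg]; exact TwoSidedIdeal.neg_mem _ hx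
    · intro y x _ hx
      rw [map_mul]; exact TwoSidedIdeal.mul_mem_left _ _ _ hx
    · intro y x _ hx
      rw [map_mul]; exact TwoSidedIdeal.mul_mem_right _ _ _ hx

theorem Ansatz.bianchiOn_of_abstractBianchi (h : c.AbstractBianchi) : c.BianchiOn m S := by
  intro G hG
  obtain ⟨x, hx, rfl⟩ := (c.mem_idealOn G).1 hG
  exact ⟨_, (c.mem_idealOn _).2 ⟨_, h x hx, rfl⟩, toFunctional_fieldD x⟩

theorem Ansatz.pointwiseBianchiOn_of_bianchiOn (h : c.BianchiOn m S) :
    c.PointwiseBianchiOn m S := by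
  intro Φ e y hF α
  -- For fixed gauge fields, evaluation at a point is a homomorphism. It kills the generators, hence
  -- the whole ideal.
  have hI : ∀ G ∈ c.idealOn m S, formAt y ((G : Functional m S U deg) Φ e) = 0 := by
    intro G hG
    refine TwoSidedIdeal.span_induction
      (p := fun (G : functionalAlg m S U deg) _ =>
        formAt y ((G : Functional m S U deg) Φ e) = 0) ?_ ?_ ?_ ?_ ?_ ?_ hG
    · rintro G ⟨β, hβ⟩
      rw [hβ]; exact hF β
    · exact map_zero _
    · intro G H _ _ hG hH
      change formAt y ((G : Functional m S U deg) Φ e + (H : Functional m S U deg) Φ e) = 0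
      rw [map_add, hG, hH, add_zero]
    · intro G _ hG
      change formAt y (-(G : Functional m S U deg) Φ e) = 0
      rw [map_neg, hG, neg_zero]
    · intro H G _ hG
      change formAt y ((H : Functional m S U deg) Φ e * (G : Functional m S U deg) Φ e) = 0
      rw [map_mul, hG, mul_zero]
    · intro H G _ hG
      change formAt y ((G : Functional m S U deg) Φ e * (H : Functional m S U deg) Φ e) = 0
      rw [map_mul, hG, zero_mul]
  obtain ⟨G', hG', e'⟩ := h _ (c.toFunctionalAlg_fieldStrength_mem α)
  rw [coe_toFunctionalAlg, toFunctional_fieldStrength] at e'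
  rw [← e']
  exact hI G' hG'

/-- On gauge fields whose field strengths vanish at a point, functions of the abstract gauge fields
are evaluated through functions on the target. -/
theorem GaugeField.formAt_eval (Φ : GaugeField m S U deg) (e : atlas (Euc m) S)
    (y : chartTarget e) (hF : ∀ β, formAt y (c.fieldStrengthOn m S β Φ e) = 0)
    (w : FieldAlg U deg) :
    formAt y (Φ.eval e w) =
      evalForms ⟨Φ.X (e.1.symm y), Φ.mem _⟩ (fun a => formAt y ((Φ.A a).inChart e))
        (fun a => hasParity_of_mem_exteriorPower ((Φ.A a).degree e y)) (c.reduce w) := by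
  set E : GradedFun U deg →ₐ[ℝ] ExtCov m :=
    evalForms ⟨Φ.X (e.1.symm y), Φ.mem _⟩ (fun a => formAt y ((Φ.A a).inChart e))
      (fun a => hasParity_of_mem_exteriorPower ((Φ.A a).degree e y)) with hE
  have base : ∀ f, formAt y (Φ.eval e (baseFun U _ f)) = E (baseFun U deg f) := fun f => by
    rw [Φ.eval_baseFun, formAt_tmul, hE, evalForms_baseFun, Algebra.algebraMap_eq_smul_one]
    rfl
  have hcoord : ∀ a, formAt y (Φ.eval e (coord U _ (.inl a))) = E (coord U deg a) := fun a => by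
    rw [Φ.eval_coord_inl, hE, evalForms_coord]
  induction w using gradedFun_induction with
  | base f => rw [c.reduce_baseFun, base]
  | coord a =>
    rcases a with a | α
    · rw [c.reduce_coord_inl, hcoord]
    -- The vanishing of $F^\alpha$ at the point says that $dA^\alpha$ equals minus the polynomial
    -- part there, just as reduction prescribes.
    · have h := hF α
      rw [← Φ.eval_fieldStrength, Ansatz.fieldStrength, map_add, map_add, Ansatz.map_poly,
        Ansatz.map_poly] at h
      simp only [base, hcoord] at h
      rw [← Ansatz.map_poly] at h
      rw [c.reduce_coord_inr, map_neg]
      exact eq_neg_of_add_eq_zero_left h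
  | add x z hx hz => rw [map_add, map_add, map_add, map_add, hx, hz]
  | mul x z hx hz => rw [map_mul, map_mul, map_mul, map_mul, hx, hz]

end Evaluation

/-! ### Global differential forms on the manifold -/

theorem sum_apply_smul_dσ {m : ℕ} (φ : Module.Dual ℝ (Euc m)) :
    ∑ μ, φ (EuclideanSpace.single μ 1) • dσ μ = φ := by
  refine LinearMap.ext fun v => ?_
  have hv : v = ∑ i, v i • EuclideanSpace.single i (1 : ℝ) := by
    ext j
    simp [Finset.sum_apply, Pi.single_apply]
  conv_rhs => rw [hv, map_sum]
  simp [LinearMap.sum_apply, dσ, mul_comm]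

/-- This coordinate-free value of $df$ allows changes of chart to be handled by the chain rule. -/
theorem formAt_localD_tmul_one {m : ℕ} {V : Opens (Euc m)} {f : SmoothFun V} {g : Euc m → ℝ}
    (h : ∀ y : V, f.1 y = g y) (y : V) :
    formAt y (localD V (f ⊗ₜ 1)) =
      ExteriorAlgebra.ι ℝ (fderiv ℝ g (y : Euc m)).toLinearMap := by
  rw [localD_tmul, map_sum, ← sum_apply_smul_dσ (fderiv ℝ g (y : Euc m)).toLinearMap, map_sum]
  refine Finset.sum_congr rfl fun μ _ => ?_
  rw [localdσ, Algebra.TensorProduct.tmul_mul_tmul, one_mul, mul_one, formAt_tmul,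
    pd_apply_of_eq h, map_smul]
  rfl

section Forms

variable {m : ℕ} {S : Type*} [TopologicalSpace S] [ChartedSpace (Euc m) S]

/-- The sum of two differential forms. -/
def DiffForm.add {k : ℕ} (A B : DiffForm m S k) : DiffForm m S k where
  inChart e := A.inChart e + B.inChart e
  degree e y := by rw [map_add]; exact add_mem (A.degree e y) (B.degree e y)
  compat e e' y y' h := by
    rw [map_add, map_add, map_add, A.compat e e' y y' h, B.compat e e' y y' h]

/-- The wedge product of two differential forms. -/
def DiffForm.mul {k l j : ℕ} (hj : k + l = j) (A : DiffForm m S k) (B : DiffForm m S l) :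
    DiffForm m S j where
  inChart e := A.inChart e * B.inChart e
  degree e y := by
    subst hj
    rw [map_mul, ExteriorAlgebra.exteriorPower, pow_add]
    exact Submodule.mul_mem_mul (A.degree e y) (B.degree e y)
  compat e e' y y' h := by
    rw [map_mul, map_mul, map_mul, A.compat e e' y y' h, B.compat e e' y y' h]

variable [IsManifold (𝓡 m) ∞ S]

theorem contDiffOn_comp_chart_symm {E : Type*} [NormedAddCommGroup E] [NormedSpace ℝ E]
    {h : S → E} (hh : ContMDiff (𝓡 m) 𝓘(ℝ, E) ∞ h) (e : atlas (Euc m) S) :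
    ContDiffOn ℝ ∞ (fun y => h (e.1.symm y)) e.1.target :=
  contMDiffOn_iff_contDiffOn.1 (hh.comp_contMDiffOn
    (contMDiffOn_symm_of_mem_maximalAtlas (IsManifold.subset_maximalAtlas e.2)))

/-- A smooth function on a manifold in a chart. -/
def chartFun (h : S → ℝ) (hh : ContMDiff (𝓡 m) 𝓘(ℝ, ℝ) ∞ h) (e : atlas (Euc m) S) :
    SmoothFun (chartTarget e) :=
  ⟨fun y => h (e.1.symm y), fun y => h (e.1.symm y), contDiffOn_comp_chart_symm hh e,
    fun _ => rfl⟩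

/-- A smooth function as a differential form of degree 0. -/
def DiffForm.ofFun (h : S → ℝ) (hh : ContMDiff (𝓡 m) 𝓘(ℝ, ℝ) ∞ h) : DiffForm m S 0 where
  inChart e := chartFun h hh e ⊗ₜ 1
  degree e y := by
    rw [formAt_tmul, ExteriorAlgebra.exteriorPower, pow_zero, ← Algebra.algebraMap_eq_smul_one]
    exact Submodule.algebraMap_mem _
  compat e e' y y' hy := by
    rw [formAt_tmul, formAt_tmul, map_smul, map_one]
    exact congrArg (fun s => h s • (1 : ExtCov m)) hy

theorem differentiableAt_transition (e e' : atlas (Euc m) S) {y : Euc m} (hy : y ∈ e.1.target)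
    (hy' : e.1.symm y ∈ e'.1.source) :
    DifferentiableAt ℝ (fun z => e'.1 (e.1.symm z)) y := by
  have h1 : ContMDiffAt (𝓡 m) (𝓡 m) ∞ e.1.symm y :=
    contMDiffAt_symm_of_mem_maximalAtlas (IsManifold.subset_maximalAtlas e.2) hy
  have h2 : ContMDiffAt (𝓡 m) (𝓡 m) ∞ e'.1 (e.1.symm y) :=
    contMDiffAt_of_mem_maximalAtlas (IsManifold.subset_maximalAtlas e'.2) hy'
  exact (contMDiffAt_iff_contDiffAt.1 (h2.comp y h1)).differentiableAt (by simp)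

/-- The differential of a smooth function. -/
def DiffForm.dFun (h : S → ℝ) (hh : ContMDiff (𝓡 m) 𝓘(ℝ, ℝ) ∞ h) : DiffForm m S 1 where
  inChart e := localD _ (chartFun h hh e ⊗ₜ 1)
  degree e y := by
    rw [formAt_localD_tmul_one (g := fun y => h (e.1.symm y)) fun _ => rfl,
      ExteriorAlgebra.exteriorPower, pow_one]
    exact LinearMap.mem_range_self _ _
  compat e e' y y' hy := by
    have hs : e.1.symm y ∈ e'.1.source := by
      rw [hy]; exact e'.1.map_target y'.2
    have hy' : e'.1 (e.1.symm y) = y' := by rw [hy]; exact e'.1.right_inv y'.2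
    rw [formAt_localD_tmul_one (g := fun y => h (e.1.symm y)) fun _ => rfl,
      formAt_localD_tmul_one (g := fun y => h (e'.1.symm y)) fun _ => rfl,
      ExteriorAlgebra.map_apply_ι]
    congr 1
    -- Near the point, the two chart expressions of `h` differ by the transition map. The chain rule
    -- for this composition is the required pullback law.
    have hev : (fun z => h (e.1.symm z)) =ᶠ[nhds (y : Euc m)]
        fun z => (fun z => h (e'.1.symm z)) (e'.1 (e.1.symm z)) := by
      have : e.1.symm ⁻¹' e'.1.source ∈ nhds (y : Euc m) :=
        (e.1.continuousAt_symm y.2).preimage_mem_nhds (e'.1.open_source.mem_nhds hs)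
      filter_upwards [this] with z hz
      exact congrArg h (e'.1.left_inv hz).symm
    have hd : DifferentiableAt ℝ (fun z => h (e'.1.symm z)) (e'.1 (e.1.symm y)) := by
      rw [hy']
      exact ((contDiffOn_comp_chart_symm hh e').differentiableOn (by simp)).differentiableAt
        (e'.1.open_target.mem_nhds y'.2)
    rw [hev.fderiv_eq, fderiv_fun_comp (g := fun z => h (e'.1.symm z)) (y : Euc m) hd
      (differentiableAt_transition e e' y.2 hs), hy']
    rfl

end Forms

/-! ### Prescribing gauge fields and their differentials at a point -/

section Jets

/-- The preferred chart at a point as an element of the atlas. -/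
def atlasAt (m : ℕ) {S : Type*} [TopologicalSpace S] [ChartedSpace (Euc m) S] (s : S) :
    atlas (Euc m) S :=
  ⟨chartAt (Euc m) s, chart_mem_atlas _ s⟩

/-- A point in the preferred chart around it. -/
def centerAt (m : ℕ) {S : Type*} [TopologicalSpace S] [ChartedSpace (Euc m) S] (s : S) :
    chartTarget (atlasAt m s) :=
  ⟨chartAt (Euc m) s s, mem_chart_target _ s⟩

theorem atlasAt_symm_centerAt {m : ℕ} {S : Type*} [TopologicalSpace S]
    [ChartedSpace (Euc m) S] (s : S) : (atlasAt m s).1.symm (centerAt m s) = s :=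
  (chartAt (Euc m) s).left_inv (mem_chart_source _ s)

variable {m : ℕ} {S : Type*} [TopologicalSpace S] [ChartedSpace (Euc m) S]
  [IsManifold (𝓡 m) ∞ S]

/-- There are globally defined functions that agree with centered coordinates near a point. -/
theorem exists_centered_coordinates [T2Space S] (s : S) : ∃ G : S → Euc m,
    ContMDiff (𝓡 m) 𝓘(ℝ, Euc m) ∞ G ∧
      (fun y => G ((atlasAt m s).1.symm y)) =ᶠ[nhds (centerAt m s : Euc m)]
        fun y => y - centerAt m s := by
  obtain ⟨f⟩ : Nonempty (SmoothBumpFunction (𝓡 m) s) := inferInstance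
  -- A bump function equal to 1 near `s` cuts the centered chart off to a global smooth map.
  refine ⟨fun t => f t • (chartAt (Euc m) s t - chartAt (Euc m) s s), ?_, ?_⟩
  · refine f.contMDiff_smul ?_
    exact (contMDiffOn_chart (I := 𝓡 m) (n := ∞)).sub contMDiffOn_const
  · have h1 : ∀ᶠ y in nhds (centerAt m s : Euc m), f ((atlasAt m s).1.symm y) = 1 := by
      have hc := ((atlasAt m s).1.continuousAt_symm (centerAt m s).2).tendsto
      rw [atlasAt_symm_centerAt] at hc
      exact hc.eventually f.eventuallyEq_one
    filter_upwards [h1, (chartTarget (atlasAt m s)).isOpen.mem_nhds (centerAt m s).2]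
      with y hy hy'
    rw [hy, one_smul]
    exact congrArg (· - _) ((chartAt (Euc m) s).right_inv hy')

/-- There are globally defined functions with arbitrary differential at a point. -/
theorem exists_function_with_differential [T2Space S] (s : S) (v : Module.Dual ℝ (Euc m)) :
    ∃ (h : S → ℝ) (hh : ContMDiff (𝓡 m) 𝓘(ℝ, ℝ) ∞ h),
      formAt (centerAt m s) ((DiffForm.ofFun h hh).inChart (atlasAt m s)) = 0 ∧
      formAt (centerAt m s) ((DiffForm.dFun h hh).inChart (atlasAt m s)) =
        ExteriorAlgebra.ι ℝ v := by
  obtain ⟨G, hG, hG'⟩ := exists_centered_coordinates (m := m) s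
  have hh : ContMDiff (𝓡 m) 𝓘(ℝ, ℝ) ∞ fun t => v (G t) :=
    (LinearMap.toContinuousLinearMap v).contDiff.contMDiff.comp hG
  refine ⟨fun t => v (G t), hh, ?_, ?_⟩
  · have := hG'.eq_of_nhds
    rw [sub_self] at this
    change formAt _ (_ ⊗ₜ 1) = _
    rw [formAt_tmul]
    change v (G ((atlasAt m s).1.symm (centerAt m s))) • _ = _
    rw [this, map_zero, zero_smul]
  · change formAt _ (localD _ (_ ⊗ₜ 1)) = _
    rw [formAt_localD_tmul_one (g := fun y => v (G ((atlasAt m s).1.symm y))) fun _ => rfl]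
    have h1 : (fun y => v (G ((atlasAt m s).1.symm y))) =ᶠ[nhds (centerAt m s : Euc m)]
        fun y => LinearMap.toContinuousLinearMap v (y - centerAt m s) :=
      hG'.fun_comp v
    rw [h1.fderiv_eq, fderiv_fun_comp (g := LinearMap.toContinuousLinearMap v) _
      (ContinuousLinearMap.differentiableAt _) (by fun_prop), ContinuousLinearMap.fderiv,
      fderiv_sub_const]
    congr 1
    ext w
    simp

/-- There are globally defined forms that are closed in a chart and have a prescribed value at its
center. -/
theorem exists_closed_form [T2Space S] (s : S) {k : ℕ} {a : ExtCov m}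
    (ha : a ∈ ⋀[ℝ]^k (Module.Dual ℝ (Euc m))) : ∃ A : DiffForm m S k,
      formAt (centerAt m s) (A.inChart (atlasAt m s)) = a ∧
        localD _ (A.inChart (atlasAt m s)) = 0 := by
  induction ha using Submodule.pow_induction_on_left' with
  | algebraMap r =>
    refine ⟨DiffForm.ofFun (fun _ => r) contMDiff_const, ?_, ?_⟩
    · change formAt _ (_ ⊗ₜ 1) = _
      rw [formAt_tmul, Algebra.algebraMap_eq_smul_one]
      rfl
    · have : (DiffForm.ofFun (m := m) (S := S) (fun _ => r) contMDiff_const).inChart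
          (atlasAt m s) = algebraMap ℝ (LocalForm _) r := rfl
      rw [this, Algebra.algebraMap_eq_smul_one, map_smul, localD_skewLeibniz.map_one, smul_zero]
  | add x y i _ _ hx hy =>
    obtain ⟨A, hA, hA'⟩ := hx
    obtain ⟨B, hB, hB'⟩ := hy
    exact ⟨A.add B, (map_add _ _ _).trans (by rw [hA, hB]),
      (map_add _ _ _).trans (by rw [hA', hB', add_zero])⟩
  | mem_mul v hv i x _ hx =>
    obtain ⟨v, rfl⟩ := hv
    obtain ⟨A, hA, hA'⟩ := hx
    obtain ⟨h, hh, -, h2⟩ := exists_function_with_differential s v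
    -- $dh\wedge A$ is closed in the chart because $d^2h=0$ and $dA=0$, and $dh$ has the prescribed
    -- value `v` at the center.
    refine ⟨.mul (add_comm 1 i) (.dFun h hh) A, ?_, ?_⟩
    · exact (map_mul _ _ _).trans (by rw [h2, hA])
    · refine (localD_skewLeibniz _ _).trans ?_
      rw [hA', mul_zero, add_zero]
      exact (congrArg (· * _) (localD_localD _)).trans (zero_mul _)

/-- There are globally defined forms that vanish at a point and have a prescribed exterior
derivative there. -/
theorem exists_form_with_differential [T2Space S] (s : S) {k : ℕ} {w : ExtCov m}
    (hw : w ∈ ⋀[ℝ]^(k + 1) (Module.Dual ℝ (Euc m))) : ∃ A : DiffForm m S k,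
      formAt (centerAt m s) (A.inChart (atlasAt m s)) = 0 ∧
        formAt (centerAt m s) (localD _ (A.inChart (atlasAt m s))) = w := by
  rw [ExteriorAlgebra.exteriorPower, pow_succ'] at hw
  induction hw using Submodule.mul_induction_on' with
  | mem_mul_mem v hv x hx =>
    obtain ⟨v, rfl⟩ := hv
    obtain ⟨A, hA, hA'⟩ := exists_closed_form s hx
    obtain ⟨h, hh, h1, h2⟩ := exists_function_with_differential s v
    -- With $h(s)=0$ and $A$ closed in the chart, $hA$ vanishes at $s$ and $d(hA)=dh\wedge A$.
    refine ⟨.mul (zero_add k) (.ofFun h hh) A, ?_, ?_⟩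
    · exact (map_mul _ _ _).trans (by rw [h1, zero_mul])
    · refine (congrArg _ (localD_skewLeibniz _ _)).trans ?_
      rw [hA', mul_zero, add_zero, map_mul, AlgHom.id_apply, hA]
      exact congrArg (· * x) h2
  | add x _ y _ hx hy =>
    obtain ⟨A, hA, hA'⟩ := hx
    obtain ⟨B, hB, hB'⟩ := hy
    refine ⟨A.add B, (map_add _ _ _).trans (by rw [hA, hB, add_zero]), ?_⟩
    change formAt _ (localD _ (_ + _)) = _
    rw [map_add, map_add, hA', hB']

/-- The sum of a form closed in the chart with the prescribed value and a form vanishing at the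
point with the prescribed differential. -/
theorem exists_form_with_jet [T2Space S] (s : S) {k : ℕ} {a w : ExtCov m}
    (ha : a ∈ ⋀[ℝ]^k (Module.Dual ℝ (Euc m)))
    (hw : w ∈ ⋀[ℝ]^(k + 1) (Module.Dual ℝ (Euc m))) : ∃ A : DiffForm m S k,
      formAt (centerAt m s) (A.inChart (atlasAt m s)) = a ∧
        formAt (centerAt m s) (localD _ (A.inChart (atlasAt m s))) = w := by
  obtain ⟨A, hA, hA'⟩ := exists_closed_form s ha
  obtain ⟨B, hB, hB'⟩ := exists_form_with_differential s hw
  refine ⟨A.add B, (map_add _ _ _).trans (by rw [hA, hB, add_zero]), ?_⟩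
  change formAt _ (localD _ (_ + _)) = _
  rw [map_add, map_add, hA', hB', map_zero, zero_add]

variable {n : ℕ}

/-- A smooth map into an arbitrarily small ball that is the identity near its center. -/
theorem exists_smooth_map_into_ball {r : ℝ} (hr : 0 < r) : ∃ H : Euc n → Euc n, ContDiff ℝ ∞ H ∧
    (∀ v, ‖H v‖ < r) ∧ H =ᶠ[nhds 0] id := by
  let φ : ContDiffBump (0 : Euc n) := ⟨r / 2, r, by linarith, by linarith⟩
  refine ⟨fun v => φ v • v, φ.contDiff.smul contDiff_id, fun v => ?_, ?_⟩
  · by_cases hv : ‖v‖ < r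
    · rw [norm_smul, Real.norm_of_nonneg φ.nonneg]
      exact (mul_le_of_le_one_left (norm_nonneg v) φ.le_one).trans_lt hv
    · have h0 : φ v = 0 := φ.zero_of_le_dist (by simpa [φ] using hv)
      simpa [h0] using hr
  · filter_upwards [φ.eventuallyEq_one] with v hv
    rw [hv, Pi.one_apply, one_smul]
    rfl

/-- There are scalar fields with prescribed value and differentials at a point. -/
theorem exists_scalars_with_jet [T2Space S] (s : S) (U : Opens (Euc n)) (x : U)
    (l : Fin n → Module.Dual ℝ (Euc m)) : ∃ X : S → Euc n,
      ContMDiff (𝓡 m) (𝓡 n) ∞ X ∧ (∀ t, X t ∈ U) ∧ X s = x ∧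
        ∀ i, fderiv ℝ (fun y => X ((atlasAt m s).1.symm y) i) (centerAt m s : Euc m) =
          LinearMap.toContinuousLinearMap (l i) := by
  obtain ⟨G, hG, hG'⟩ := exists_centered_coordinates (m := m) s
  obtain ⟨r, hr, hrU⟩ := Metric.isOpen_iff.1 U.isOpen x x.2
  obtain ⟨H, hH, hHr, hH'⟩ := exists_smooth_map_into_ball (n := n) hr
  let L : Euc m →L[ℝ] Euc n := LinearMap.toContinuousLinearMap
    ((WithLp.linearEquiv 2 ℝ (Fin n → ℝ)).symm.toLinearMap ∘ₗ LinearMap.pi l)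
  have hL : ∀ v i, L v i = l i v := fun v i => rfl
  have hG0 : G s = 0 := by
    have := hG'.eq_of_nhds
    rwa [sub_self, atlasAt_symm_centerAt] at this
  -- `L ∘ G` has the desired differentials at `s`. Composing with `H`, the identity near 0, keeps
  -- the global map in a ball around `x` inside `U` without changing them.
  refine ⟨fun t => x + H (L (G t)), ?_, fun t => hrU ?_, ?_, fun i => ?_⟩
  · have h1 : ContDiff ℝ ∞ fun v : Euc m => (x : Euc n) + H (L v) :=
      contDiff_const.add (hH.comp L.contDiff)
    exact h1.contMDiff.comp hG
  · rw [Metric.mem_ball, dist_eq_norm, add_sub_cancel_left]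
    exact hHr _
  · change (x : Euc n) + H (L (G s)) = x
    rw [hG0, map_zero, hH'.eq_of_nhds, id, add_zero]
  · have h1 : (fun y => ((x : Euc n) + H (L (G ((atlasAt m s).1.symm y)))) i)
        =ᶠ[nhds (centerAt m s : Euc m)]
        fun y => (x : Euc n) i + LinearMap.toContinuousLinearMap (l i) (y - centerAt m s) := by
      have ht : Filter.Tendsto (fun y : Euc m => L (y - centerAt m s))
          (nhds (centerAt m s : Euc m)) (nhds 0) := by
        have : ContinuousAt (fun y : Euc m => L (y - centerAt m s)) (centerAt m s : Euc m) := by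
          fun_prop
        simpa [ContinuousAt] using this
      filter_upwards [hG', ht.eventually hH'] with y hy hy'
      rw [hy, hy']
      simp [hL]
    rw [h1.fderiv_eq, fderiv_const_add, fderiv_fun_comp
      (g := LinearMap.toContinuousLinearMap (l i)) _
      (ContinuousLinearMap.differentiableAt _) (by fun_prop), ContinuousLinearMap.fderiv,
      fderiv_sub_const]
    ext w
    simp

variable {ι : Type*} {U : Opens (Euc n)} {deg : ι → ℕ}

/-- There are gauge fields with prescribed values and exterior derivatives at a point. -/
theorem exists_gaugeField_with_jet [T2Space S] (s : S) (x : U) {A : ι → ExtCov m}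
    (hA : ∀ a, A a ∈ ⋀[ℝ]^(deg a) (Module.Dual ℝ (Euc m))) {w : Fin n ⊕ ι → ExtCov m}
    (hw : ∀ α, w α ∈ ⋀[ℝ]^(fieldDeg n deg α + 1) (Module.Dual ℝ (Euc m))) :
    ∃ Φ : GaugeField m S U deg, Φ.X s = x ∧
      (∀ a, formAt (centerAt m s) ((Φ.A a).inChart (atlasAt m s)) = A a) ∧
      ∀ α, formAt (centerAt m s) (localD _ (gaugeFunctional m S U deg α Φ (atlasAt m s))) =
        w α := by
  have hl : ∀ i : Fin n, ∃ l : Module.Dual ℝ (Euc m), ExteriorAlgebra.ι ℝ l = w (.inl i) := by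
    intro i
    have := hw (.inl i)
    rw [ExteriorAlgebra.exteriorPower, fieldDeg, Sum.elim_inl, zero_add, pow_one] at this
    exact this
  choose l hl using hl
  obtain ⟨X, hX, hXU, hXs, hX'⟩ := exists_scalars_with_jet s U x l
  choose B hB hB' using fun a => exists_form_with_jet s (hA a) (hw (.inr a))
  refine ⟨⟨X, hX, hXU, B⟩, hXs, hB, ?_⟩
  rintro (i | a)
  · change formAt _ (localD _ (_ ⊗ₜ 1)) = _
    rw [formAt_localD_tmul_one (g := fun y => X ((atlasAt m s).1.symm y) i) fun _ => rfl, hX',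
      ← hl]
    rfl
  · exact hB' a

theorem evalForms_congr {M : Type*} [AddCommGroup M] [Module ℝ M] {x x' : U}
    {A A' : ι → ExteriorAlgebra ℝ M} (hA : ∀ a, HasParity (extParity M) (deg a) (A a))
    (hA' : ∀ a, HasParity (extParity M) (deg a) (A' a)) (h : x = x') (h' : ∀ a, A a = A' a)
    (w : GradedFun U deg) : evalForms x A hA w = evalForms x' A' hA' w := by
  obtain rfl := h
  obtain rfl := funext h'
  rfl

variable [Fintype ι] (c : Ansatz U deg)

/-- The degree check needed to prescribe this value, up to sign, as $dA^\alpha$ at a point. -/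
theorem Ansatz.evalForms_component_mem {M : Type*} [AddCommGroup M] [Module ℝ M] (x : U)
    {A : ι → ExteriorAlgebra ℝ M} (hA : ∀ a, A a ∈ ⋀[ℝ]^(deg a) M) (α : Fin n ⊕ ι) :
    evalForms x A (fun a => hasParity_of_mem_exteriorPower (hA a)) (c.component α) ∈
      ⋀[ℝ]^(fieldDeg n deg α + 1) M := by
  rw [Ansatz.component, Ansatz.map_poly]
  simp only [evalForms_baseFun, evalForms_coord]
  refine c.poly_mem (map_zero (algebraMap ℝ (ExteriorAlgebra ℝ M))) A α fun f l hl => ?_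
  rw [← hl, ← Algebra.smul_def]
  refine Submodule.smul_mem _ _ ?_
  clear hl
  induction l with
  | nil => exact Submodule.one_le.1 (pow_zero _).ge
  | cons a l ih =>
    simp only [List.map_cons, List.prod_cons, List.sum_cons]
    rw [ExteriorAlgebra.exteriorPower, pow_add]
    exact Submodule.mul_mem_mul (hA a) ih

/-- The pointwise Bianchi identities imply that `Q² = 0`, since gauge fields with vanishing field
strength at a point have arbitrary values there. -/
theorem Ansatz.Q_sq_of_pointwiseBianchiOn [T2Space S] [Nonempty S] (hpos : ∀ a, 1 ≤ deg a)
    (hdim : ∀ α, fieldDeg n deg α + 2 ≤ m) (h : c.PointwiseBianchiOn m S) :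
    c.Q ∘ₗ c.Q = 0 := by
  refine c.Q_sq_eq_zero fun α => ?_
  by_contra h0
  obtain ⟨s⟩ := ‹Nonempty S›
  -- The coordinate covectors and their duals, continued by zero so that the detection argument can
  -- index directions by natural numbers.
  let e : ℕ → Module.Dual ℝ (Euc m) := fun j => if hj : j < m then dσ ⟨j, hj⟩ else 0
  let v : ℕ → Module.Dual ℝ (Module.Dual ℝ (Euc m)) := fun j =>
    if hj : j < m then Module.Dual.eval ℝ _ (EuclideanSpace.single ⟨j, hj⟩ 1) else 0
  have hve : ∀ i j, i ≠ j → v i (e j) = 0 := by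
    intro i j hij
    by_cases hi : i < m <;> by_cases hj : j < m <;> simp [v, e, hi, hj, dσ, Ne.symm hij]
  have hve1 : ∀ i, i < m → v i (e i) = 1 := by
    intro i hi
    simp [v, e, hi, dσ]
  obtain ⟨x, A, hA, -, hev⟩ := exists_evalForms_ne_zero hve hve1 hpos _ (hdim α) _
    (c.Q_mem_homog (c.component_mem_homog α)) h0
  -- The values of $A$ are those on which $Q(Q^\alpha)$ is nonzero. The differentials are chosen to
  -- be exactly those that make all field strengths vanish at `s`.
  obtain ⟨Φ, hX, hΦA, hΦw⟩ := exists_gaugeField_with_jet s x hA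
    (w := fun α => -evalForms x A (fun a => hasParity_of_mem_exteriorPower (hA a))
      (c.component α)) fun α => neg_mem (c.evalForms_component_mem x hA α)
  have hX' : (⟨Φ.X ((atlasAt m s).1.symm (centerAt m s)), Φ.mem _⟩ : U) = x :=
    Subtype.ext ((congrArg Φ.X (atlasAt_symm_centerAt s)).trans hX)
  have hF : ∀ β, formAt (centerAt m s) (c.fieldStrengthOn m S β Φ (atlasAt m s)) = 0 := by
    intro β
    rw [← Φ.eval_fieldStrength, Ansatz.fieldStrength, map_add, map_add, Φ.eval_coord_inr, hΦw,
      Ansatz.map_poly, Ansatz.map_poly, Ansatz.component, Ansatz.map_poly]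
    simp only [Φ.eval_baseFun, Φ.eval_coord_inl, hΦA, evalForms_baseFun, evalForms_coord,
      formAt_tmul, ← Algebra.algebraMap_eq_smul_one, ← hX']
    exact neg_add_cancel _
  -- At this point $dF^\alpha$ equals $-Q(Q^\alpha)$ evaluated on the chosen values, so its
  -- vanishing contradicts their choice.
  have hd := h Φ (atlasAt m s) (centerAt m s) hF α
  rw [← toFunctional_fieldStrength, ← toFunctional_fieldD, toFunctional_apply,
    Φ.formAt_eval c _ _ hF, c.reduce_fieldD_fieldStrength, map_neg, neg_eq_zero,
    evalForms_congr _ (fun a => hasParity_of_mem_exteriorPower (hA a)) hX' hΦA] at hd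
  exact hev hd

end Jets

end HigherGauge

end

theorem theorem1 {p m n : ℕ} {ι : Type*} [Fintype ι]
    (S : Type*) [TopologicalSpace S] [T2Space S] [Nonempty S]
    [ChartedSpace (HigherGauge.Euc m) S] [IsManifold (𝓡 m) ∞ S]
    (U : Opens (HigherGauge.Euc n)) (deg : ι → ℕ)
    (hpos : ∀ a, 1 ≤ deg a) (hle : ∀ a, deg a ≤ p) (hdim : p + 2 ≤ m)
    (c : HigherGauge.Ansatz U deg) :
    (c.BianchiOn m S ↔ c.Q ∘ₗ c.Q = 0) ∧
      (c.AbstractBianchi ↔ c.Q ∘ₗ c.Q = 0) ∧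
      (c.PointwiseBianchiOn m S ↔ c.Q ∘ₗ c.Q = 0) := by
  have hdim' : ∀ α, HigherGauge.fieldDeg n deg α + 2 ≤ m := by
    rintro (i | a)
    · simp only [HigherGauge.fieldDeg, Sum.elim_inl]; omega
    · have := hle a
      simp only [HigherGauge.fieldDeg, Sum.elim_inr]; omega
  have h1 : c.Q ∘ₗ c.Q = 0 → c.BianchiOn m S := fun h =>
    c.bianchiOn_of_abstractBianchi (c.abstractBianchi_of_Q_sq h)
  have h2 : c.PointwiseBianchiOn m S → c.Q ∘ₗ c.Q = 0 :=
    c.Q_sq_of_pointwiseBianchiOn hpos hdim'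
  -- The implications close up as: $Q^2=0$, abstract, on the manifold, pointwise, $Q^2=0$. The
  -- abstract form also returns to $Q^2=0$ directly, without using the manifold.
  exact ⟨⟨fun h => h2 (c.pointwiseBianchiOn_of_bianchiOn h), h1⟩,
    ⟨c.Q_sq_of_abstractBianchi, c.abstractBianchi_of_Q_sq⟩,
    ⟨h2, fun h => c.pointwiseBianchiOn_of_bianchiOn (h1 h)⟩⟩
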